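/- Let $K$ be a field, let $\Lambda$ be a finite-dimensional associative unital $K$-algebra, and let $n\ge 0$ be an integer. Write $\operatorname{mod}\Lambda$ for the category of finitely generated right $\Lambda$-modules. For $C\in\operatorname{mod}\Lambda$ let $\Omega^{-n}C$ be its $n$-th cosyzygy, i.e. $\Omega^{0}C=C$ and $\Omega^{-(n+1)}C=\Omega^{-n}(I/C)$, where $C\hookrightarrow I$ is an injective envelope of $C$. Let $\Omega^{-n}(\operatorname{mod}\Lambda)$ be the subcategory of $\operatorname{mod}\Lambda$ of all modules isomorphic to $\Omega^{-n}C\oplus I$ with $C\in\operatorname{mod}\Lambda$ and $I\in\operatorname{mod}\Lambda$ injective. For a subcategory $\mathcal C$ of $\operatorname{mod}\Lambda$ and $m\ge 0$, let $\mathcal C^{*m}$ consist of all $X\in\operatorname{mod}\Lambda$ having a filtration $X=X_0\supseteq X_1\supseteq\cdots\supseteq X_m=0$ by submodules with $X_i/X_{i+1}\in\mathcal C$ for $0\le i<m$, and let $\operatorname{add}\mathcal C$ consist of all direct summands of finite direct sums of modules in $\mathcal C$. Put $$\mathcal Y_n^m(\Lambda)=\operatorname{add}\bigl(\Omega^{-n}(\operatorname{mod}\Lambda)^{*m}\bigr),\qquad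 \mathcal Y_n(\Lambda)=\bigcup_{m\ge 0}\mathcal Y_n^m(\Lambda),$$ and let $\mathcal P_n(\Lambda)$ be the subcategory of all modules in $\operatorname{mod}\Lambda$ of projective dimension at most $n$. A subcategory $\mathcal C$ of $\operatorname{mod}\Lambda$ is *contravariantly finite* if for every $M\in\operatorname{mod}\Lambda$ there is a morphism $f\colon C_M\to M$ with $C_M\in\mathcal C$ such that every morphism $C\to M$ with $C\in\mathcal C$ factors through $f$; dually, it is *covariantly finite* if for every $M\in\operatorname{mod}\Lambda$ there is a morphism $f\colon M\to C_M$ with $C_M\in\mathcal C$ such that every morphism $M\to C$ with $C\in\mathcal C$ factors through $f$. Consider the following conditions: 1. $\mathcal P_n(\Lambda)$ is contravariantly finite. 2. $\mathcal Y_n(\Lambda)$ is covariantly finite. 3. $\mathcal Y_n^m(\Lambda)$ is closed under extensions for some $m>0$. 4. $\mathcal Y_n(\Lambda)=\mathcal Y_n^m(\Lambda)$ for some $m>0$. 5. $\mathcal Y_n^1(\Lambda)$ is closed under extensions. Then $(5)\Rightarrow(4)\Leftrightarrow(3)\Leftrightarrow(2)\Rightarrow(1)$. -/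

import Mathlib

open CategoryTheory

universe u

namespace ModSubcat

variable {R : Type u} [Ring R]

/-- `f : M ⟶ I` is an injective envelope (in the category of finitely generated modules): `I` is a
finitely generated injective module, `f` is injective, and the image of `f` is an essential
submodule of `I`. -/
structure IsInjectiveEnvelope {M I : ModuleCat.{u} R} (f : M ⟶ I) : Prop where
  finite : Module.Finite R I
  injective : Module.Injective R I
  injective_hom : Function.Injective f.hom
  essential : ∀ N : Submodule R I, N ⊓ LinearMap.range f.hom = ⊥ → N = ⊥

/-- `IsCosyzygy n M Z`: the module `Z` is (isomorphic to) the `n`-th cosyzygy of `M`, that is, the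
`n`-th cokernel in a minimal injective resolution of `M`. The first cosyzygy is the cokernel of an
injective envelope, and the `(n+1)`-st cosyzygy of `M` is the `n`-th cosyzygy of the first one. -/
def IsCosyzygy : ℕ → ModuleCat.{u} R → ModuleCat.{u} R → Prop
  | 0, M, Z => Nonempty (Z ≃ₗ[R] M)
  | n + 1, M, Z => ∃ (I : ModuleCat.{u} R) (f : M ⟶ I), IsInjectiveEnvelope f ∧
      IsCosyzygy n (ModuleCat.of R (I ⧸ LinearMap.range f.hom)) Z

/-- The subcategory of all modules isomorphic to `Ω⁻ⁿ C ⊕ I` with `C` a finitely generated module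
and `I` a finitely generated injective module. -/
def cosyzygies (R : Type u) [Ring R] (n : ℕ) : ObjectProperty (ModuleCat.{u} R) := fun X =>
  ∃ C Z I : ModuleCat.{u} R, Module.Finite R C ∧ IsCosyzygy n C Z ∧
    Module.Finite R I ∧ Module.Injective R I ∧ Nonempty (X ≃ₗ[R] Z × I)

/-- The subcategory of all finitely generated modules `X` that have a filtration
`X = X₀ ⊇ X₁ ⊇ ⋯ ⊇ Xₘ = 0` with all factors `Xᵢ / Xᵢ₊₁` (`0 ≤ i < m`) in `P`. -/
def filtered (P : ObjectProperty (ModuleCat.{u} R)) (m : ℕ) : ObjectProperty (ModuleCat.{u} R) :=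
  fun X => Module.Finite R X ∧ ∃ F : ℕ → Submodule R X, Antitone F ∧ F 0 = ⊤ ∧ F m = ⊥ ∧
    ∀ i < m, P (ModuleCat.of R (F i ⧸ (F (i + 1)).submoduleOf (F i)))

/-- `add P`: the direct summands of finite direct sums of modules in `P`. -/
def addClosure (P : ObjectProperty (ModuleCat.{u} R)) : ObjectProperty (ModuleCat.{u} R) :=
  fun X => ∃ (k : ℕ) (Y : Fin k → ModuleCat.{u} R) (i : X →ₗ[R] (∀ j, Y j))
    (p : (∀ j, Y j) →ₗ[R] X), (∀ j, P (Y j)) ∧ p ∘ₗ i = LinearMap.id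

/-- A subcategory of the category of finitely generated modules is contravariantly finite if every
finitely generated module has a right approximation by it. -/
def ContravariantlyFinite (P : ObjectProperty (ModuleCat.{u} R)) : Prop :=
  ∀ M : ModuleCat.{u} R, Module.Finite R M → ∃ (C : ModuleCat.{u} R) (f : C ⟶ M), P C ∧
    ∀ (D : ModuleCat.{u} R) (g : D ⟶ M), P D → ∃ h : D ⟶ C, h ≫ f = g

/-- A subcategory of the category of finitely generated modules is covariantly finite if every
finitely generated module has a left approximation by it. -/
def CovariantlyFinite (P : ObjectProperty (ModuleCat.{u} R)) : Prop :=
  ∀ M : ModuleCat.{u} R, Module.Finite R M → ∃ (C : ModuleCat.{u} R) (f : M ⟶ C), P C ∧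
    ∀ (D : ModuleCat.{u} R) (g : M ⟶ D), P D → ∃ h : C ⟶ D, f ≫ h = g

/-- `𝒫ₙ`: the finitely generated modules of projective dimension at most `n`. -/
def projDimLE (R : Type u) [Ring R] (n : ℕ) : ObjectProperty (ModuleCat.{u} R) := fun X =>
  Module.Finite R X ∧ HasProjectiveDimensionLE X n

/-- `𝒴ₙᵐ = add (Ω⁻ⁿ(mod)^{*m})`. -/
def yLevel (R : Type u) [Ring R] (n m : ℕ) : ObjectProperty (ModuleCat.{u} R) :=
  addClosure (filtered (cosyzygies R n) m)

/-- `𝒴ₙ`, the union of all `𝒴ₙᵐ`, `m ≥ 0`. -/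
def yUnion (R : Type u) [Ring R] (n : ℕ) : ObjectProperty (ModuleCat.{u} R) := fun X =>
  ∃ m : ℕ, yLevel R n m X

end ModSubcat

/-! Put `R = Λᵐᵒᵖ`, an artinian ring whose finitely generated modules embed into finitely generated
injectives. An extension of a module of level `b` by one of level `a` has level `a + b`
(`yLevel_add`), so the union `𝒴ₙ` is closed under extensions, and a positive level is closed under
extensions exactly when it equals `𝒴ₙ`. Each single level is covariantly finite, because this
property passes from cosyzygies to extensions and summands (`covariantlyFinite_yLevel`). This
settles everything except the consequences of covariant finiteness of `𝒴ₙ`.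

For those, Ext orthogonality is the tool. Dimension shifting shows that `Extⁱ(Q, Y) = 0` for `i ≥
1`, `pd Q ≤ n` and `Y` in `𝒴ₙ`. Conversely, if `Q` is finitely generated and `Ext¹(Q, -)` vanishes
on `𝒴ₙ`, then `Extⁿ⁺¹(Q, -)` vanishes on finitely generated modules, so `pd Q ≤ n`. By Wakamatsu's
lemma the cokernel of a minimal left `𝒴ₙ`-approximation has this vanishing. Hence every `M` embeds
into some `Y` in `𝒴ₙ` with cokernel of projective dimension at most `n`
(`exists_special_minimalLeftApprox`).

Applied to a syzygy of `M` and pushed out, such an embedding gives a right `𝒫ₙ`-approximation of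
`M`. To bound levels, one approximation of `R / J` fixes a level `m` that serves every module killed
by the Jacobson radical `J`. A horseshoe argument along the `J`-adic filtration
(`hasSpecialEmbedding_of_star`) then gives one level for all `M`. If `M` itself lies in `𝒴ₙ`, its
embedding splits, so `M` has that level. -/

namespace ModSubcat

/-! ### Short exact sequences of modules, pushouts and pullbacks -/

section LinearAlgebra

variable {R : Type u} [Ring R]

/-- `0 → A → B → C → 0` is a short exact sequence of modules. -/
structure IsSES {A B C : Type u} [AddCommGroup A] [Module R A] [AddCommGroup B] [Module R B]
    [AddCommGroup C] [Module R C] (i : A →ₗ[R] B) (p : B →ₗ[R] C) : Prop where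
  inj : Function.Injective i
  surj : Function.Surjective p
  exact : ∀ x, p x = 0 ↔ ∃ a, i a = x

namespace IsSES

variable {A B C : Type u} [AddCommGroup A] [Module R A] [AddCommGroup B] [Module R B]
    [AddCommGroup C] [Module R C] {i : A →ₗ[R] B} {p : B →ₗ[R] C}

theorem apply_apply (h : IsSES i p) (a : A) : p (i a) = 0 := (h.exact _).2 ⟨a, rfl⟩

theorem comp_eq_zero (h : IsSES i p) : p ∘ₗ i = 0 := LinearMap.ext h.apply_apply

theorem range_eq_ker (h : IsSES i p) : LinearMap.range i = LinearMap.ker p := by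
  ext x
  simp [h.exact]

theorem shortExact (h : IsSES i p) :
    (ShortComplex.mk (ModuleCat.ofHom i) (ModuleCat.ofHom p)
      (by rw [← ModuleCat.ofHom_comp, h.comp_eq_zero]; rfl)).ShortExact :=
  have : Mono (ModuleCat.ofHom i) := (ModuleCat.mono_iff_injective _).2 h.inj
  have : Epi (ModuleCat.ofHom p) := (ModuleCat.epi_iff_surjective _).2 h.surj
  { exact := (ShortComplex.moduleCat_exact_iff _).2 fun x hx => (h.exact x).1 hx }

theorem of_shortExact {S : ShortComplex (ModuleCat.{u} R)} (h : S.ShortExact) :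
    IsSES S.f.hom S.g.hom where
  inj := (ModuleCat.mono_iff_injective _).1 h.mono_f
  surj := (ModuleCat.epi_iff_surjective _).1 h.epi_g
  exact x := ⟨(ShortComplex.moduleCat_exact_iff _).1 h.exact x, by
    rintro ⟨a, rfl⟩
    exact congr($(S.zero).hom a)⟩

theorem subtype_mkQ (N : Submodule R B) : IsSES N.subtype N.mkQ where
  inj := N.injective_subtype
  surj := N.mkQ_surjective
  exact x := by simp

theorem of_injective {f : A →ₗ[R] B} (hf : Function.Injective f) :
    IsSES f (LinearMap.range f).mkQ where
  inj := hf
  surj := Submodule.mkQ_surjective _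
  exact x := by simp

theorem of_surjective {f : B →ₗ[R] C} (hf : Function.Surjective f) :
    IsSES (LinearMap.ker f).subtype f where
  inj := Submodule.injective_subtype _
  surj := hf
  exact x := by simp

theorem zero_left : IsSES (0 : PUnit.{u + 1} →ₗ[R] A) (LinearMap.id) where
  inj _ _ _ := rfl
  surj := Function.surjective_id
  exact x := by simp [eq_comm]

theorem zero_right : IsSES (LinearMap.id) (0 : A →ₗ[R] PUnit.{u + 1}) where
  inj := Function.injective_id
  surj _ := ⟨0, rfl⟩
  exact x := by simp

theorem prodMap {A' B' C' : Type u} [AddCommGroup A'] [Module R A'] [AddCommGroup B']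
    [Module R B'] [AddCommGroup C'] [Module R C'] {i' : A' →ₗ[R] B'} {p' : B' →ₗ[R] C'}
    (h : IsSES i p) (h' : IsSES i' p') : IsSES (i.prodMap i') (p.prodMap p') where
  inj := Function.Injective.prodMap h.inj h'.inj
  surj := Function.Surjective.prodMap h.surj h'.surj
  exact x := by
    obtain ⟨a, b⟩ := x
    simp [h.exact, h'.exact]

theorem nonempty_equiv_quotient (h : IsSES i p) :
    Nonempty ((B ⧸ LinearMap.range i) ≃ₗ[R] C) := by
  rw [h.range_eq_ker]
  exact ⟨p.quotKerEquivOfSurjective h.surj⟩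

theorem finite_middle (h : IsSES i p) [Module.Finite R A] [Module.Finite R C] :
    Module.Finite R B :=
  have := Module.Finite.range i
  have : Module.Finite R (B ⧸ LinearMap.range i) :=
    Module.Finite.equiv h.nonempty_equiv_quotient.some.symm
  Module.Finite.of_submodule_quotient (LinearMap.range i)

theorem finite_right (h : IsSES i p) [Module.Finite R B] : Module.Finite R C :=
  Module.Finite.of_surjective p h.surj

theorem finite_left [IsNoetherianRing R] (h : IsSES i p) [Module.Finite R B] :
    Module.Finite R A :=
  have : IsNoetherian R B := isNoetherian_of_isNoetherianRing_of_finite R B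
  Module.Finite.of_injective i h.inj

/-- A linear map killing the image of `i` factors through the cokernel. -/
theorem exists_desc (h : IsSES i p) {D : Type u} [AddCommGroup D] [Module R D] (f : B →ₗ[R] D)
    (hf : f ∘ₗ i = 0) : ∃ g : C →ₗ[R] D, g ∘ₗ p = f := by
  have hle : LinearMap.range i ≤ LinearMap.ker f := by
    rintro _ ⟨a, rfl⟩
    exact congr($hf a)
  rw [h.range_eq_ker] at hle
  refine ⟨(LinearMap.ker p).liftQ f hle ∘ₗ (p.quotKerEquivOfSurjective h.surj).symm, ?_⟩
  ext x
  have : (p.quotKerEquivOfSurjective h.surj).symm (p x) = (LinearMap.ker p).mkQ x := by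
    rw [LinearEquiv.symm_apply_eq]
    rfl
  simp [this]

/-- A linear map killed by `p` factors through the kernel. -/
theorem exists_lift (h : IsSES i p) {D : Type u} [AddCommGroup D] [Module R D] (f : D →ₗ[R] B)
    (hf : p ∘ₗ f = 0) : ∃ g : D →ₗ[R] A, i ∘ₗ g = f := by
  have hle : ∀ x, f x ∈ LinearMap.range i := fun x => (h.exact _).1 congr($hf x)
  refine ⟨(LinearEquiv.ofInjective i h.inj).symm ∘ₗ f.codRestrict _ hle, ?_⟩
  ext x
  simp

theorem congr_right (h : IsSES i p) {C' : Type u} [AddCommGroup C'] [Module R C']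
    (e : C ≃ₗ[R] C') : IsSES i (e.toLinearMap ∘ₗ p) where
  inj := h.inj
  surj := e.surjective.comp h.surj
  exact x := by simp [h.exact]

theorem congr_middle (h : IsSES i p) {B' : Type u} [AddCommGroup B'] [Module R B']
    (e : B ≃ₗ[R] B') : IsSES (e.toLinearMap ∘ₗ i) (p ∘ₗ e.symm.toLinearMap) where
  inj := e.injective.comp h.inj
  surj := h.surj.comp e.symm.surjective
  exact x := by simp [h.exact, LinearEquiv.eq_symm_apply]

end IsSES

/-- Pushout of a short exact sequence along a map out of the first term. -/
theorem exists_pushout {A B C A' : Type u} [AddCommGroup A] [Module R A] [AddCommGroup B]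
    [Module R B] [AddCommGroup C] [Module R C] [AddCommGroup A'] [Module R A'] {i : A →ₗ[R] B}
    {p : B →ₗ[R] C} (h : IsSES i p) (a : A →ₗ[R] A') :
    ∃ (B' : ModuleCat.{u} R) (i' : A' →ₗ[R] B') (p' : B' →ₗ[R] C) (b : B →ₗ[R] B'),
      IsSES i' p' ∧ p' ∘ₗ b = p ∧ b ∘ₗ i = i' ∘ₗ a ∧
      ∀ (D : ModuleCat.{u} R) (f : B →ₗ[R] D) (g : A' →ₗ[R] D), f ∘ₗ i = g ∘ₗ a →
        ∃ k : B' →ₗ[R] D, k ∘ₗ b = f ∧ k ∘ₗ i' = g := by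
  let N : Submodule R (A' × B) := LinearMap.range (a.prod (-i))
  let i' := N.mkQ ∘ₗ LinearMap.inl R A' B
  let b := N.mkQ ∘ₗ LinearMap.inr R A' B
  have hN : ∀ {D : Type u} [AddCommGroup D] [Module R D] (f : B →ₗ[R] D) (g : A' →ₗ[R] D),
      f ∘ₗ i = g ∘ₗ a → N ≤ LinearMap.ker (g.coprod f) := by
    rintro D _ _ f g hfg _ ⟨x, rfl⟩
    have : f (i x) = g (a x) := congr($hfg x)
    simp [this]
  let p' : ((A' × B) ⧸ N) →ₗ[R] C := N.liftQ ((0 : A' →ₗ[R] C).coprod p)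
    (hN p 0 (by simp [h.comp_eq_zero]))
  refine ⟨ModuleCat.of R ((A' × B) ⧸ N), i', p', b, ⟨?_, ?_, ?_⟩, ?_, ?_, ?_⟩
  · rw [← LinearMap.ker_eq_bot, LinearMap.ker_eq_bot']
    intro x hx
    obtain ⟨y, hy⟩ := (Submodule.Quotient.mk_eq_zero N).1 hx
    simp only [LinearMap.prod_apply, Function.prod_apply, LinearMap.neg_apply, LinearMap.inl_apply,
      Prod.mk.injEq, neg_eq_zero] at hy
    have := (map_eq_zero_iff _ h.inj).1 hy.2
    simp [← hy.1, this]
  · intro c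
    obtain ⟨x, rfl⟩ := h.surj c
    exact ⟨b x, by simp [p', b]⟩
  · intro x
    obtain ⟨⟨y, z⟩, rfl⟩ := N.mkQ_surjective x
    simp only [p', Submodule.mkQ_apply, Submodule.liftQ_apply, LinearMap.coprod_apply,
      LinearMap.zero_apply, zero_add, h.exact]
    constructor
    · rintro ⟨w, rfl⟩
      refine ⟨y + a w, ?_⟩
      refine (Submodule.Quotient.eq N).2 ⟨w, ?_⟩
      simp
    · rintro ⟨w, hw⟩
      obtain ⟨v, hv⟩ := (Submodule.Quotient.eq N).1 hw
      simp only [LinearMap.prod_apply, Function.prod_apply, LinearMap.neg_apply, LinearMap.inl_apply,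
        Prod.mk_sub_mk, zero_sub, Prod.mk.injEq, neg_inj] at hv
      exact ⟨v, hv.2⟩
  · ext x
    simp [p', b]
  · ext x
    refine (Submodule.Quotient.eq N).2 ⟨-x, ?_⟩
    simp
  · intro D f g hfg
    refine ⟨N.liftQ (g.coprod f) (hN f g hfg), ?_, ?_⟩
    · ext x
      simp [b]
    · ext x
      simp [i']

/-- Pullback of a short exact sequence along a map into the last term. -/
theorem exists_pullback {A B C C' : Type u} [AddCommGroup A] [Module R A] [AddCommGroup B]
    [Module R B] [AddCommGroup C] [Module R C] [AddCommGroup C'] [Module R C'] {i : A →ₗ[R] B}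
    {p : B →ₗ[R] C} (h : IsSES i p) (c : C' →ₗ[R] C) :
    ∃ (B' : ModuleCat.{u} R) (i' : A →ₗ[R] B') (p' : B' →ₗ[R] C') (b : B' →ₗ[R] B),
      IsSES i' p' ∧ b ∘ₗ i' = i ∧ p ∘ₗ b = c ∘ₗ p' ∧
      ∀ (D : ModuleCat.{u} R) (f : D →ₗ[R] B) (g : D →ₗ[R] C'), p ∘ₗ f = c ∘ₗ g →
        ∃ k : D →ₗ[R] B', b ∘ₗ k = f ∧ p' ∘ₗ k = g := by
  let N : Submodule R (B × C') :=
    LinearMap.ker (p ∘ₗ LinearMap.fst R B C' - c ∘ₗ LinearMap.snd R B C')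
  have hN : ∀ x : B × C', x ∈ N ↔ p x.1 = c x.2 := fun x => by simp [N, sub_eq_zero]
  refine ⟨ModuleCat.of R N, (LinearMap.inl R B C' ∘ₗ i).codRestrict N fun x => by
      simp [hN, h.apply_apply], LinearMap.snd R B C' ∘ₗ N.subtype,
      LinearMap.fst R B C' ∘ₗ N.subtype, ⟨?_, ?_, ?_⟩, ?_, ?_, ?_⟩
  · intro x y hxy
    exact h.inj congr(($hxy).1.1)
  · intro y
    obtain ⟨x, hx⟩ := h.surj (c y)
    exact ⟨⟨(x, y), (hN _).2 hx⟩, rfl⟩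
  · rintro ⟨⟨x, y⟩, hxy⟩
    rw [hN] at hxy
    constructor
    · intro hy
      obtain rfl : y = 0 := hy
      obtain ⟨a, rfl⟩ := (h.exact x).1 (by simpa using hxy)
      exact ⟨a, rfl⟩
    · rintro ⟨a, ha⟩
      exact congr(($ha).1.2).symm
  · rfl
  · ext x
    exact (hN _).1 x.2
  · intro D f g hfg
    exact ⟨(f.prod g).codRestrict N fun x => (hN _).2 congr($hfg x), rfl, rfl⟩

/-- In a morphism of short exact sequences that is the identity on the last terms, the
cokernel of the middle map is the cokernel of the first map. -/
theorem IsSES.cokernel_middle {A B C A' B' Q : Type u} [AddCommGroup A] [Module R A]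
    [AddCommGroup B] [Module R B] [AddCommGroup C] [Module R C] [AddCommGroup A'] [Module R A']
    [AddCommGroup B'] [Module R B'] [AddCommGroup Q] [Module R Q] {i : A →ₗ[R] B}
    {p : B →ₗ[R] C} {i' : A' →ₗ[R] B'} {p' : B' →ₗ[R] C} {a : A →ₗ[R] A'} {q : A' →ₗ[R] Q}
    {b : B →ₗ[R] B'} (h : IsSES i p) (h' : IsSES i' p') (ha : IsSES a q)
    (hb : b ∘ₗ i = i' ∘ₗ a) (hp : p' ∘ₗ b = p) {q' : B' →ₗ[R] Q} (hq : q' ∘ₗ i' = q)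
    (hq' : q' ∘ₗ b = 0) : IsSES b q' := by
  replace hb : ∀ x, b (i x) = i' (a x) := fun x => congr($hb x)
  replace hp : ∀ x, p' (b x) = p x := fun x => congr($hp x)
  replace hq : ∀ x, q' (i' x) = q x := fun x => congr($hq x)
  replace hq' : ∀ x, q' (b x) = 0 := fun x => congr($hq' x)
  refine ⟨?_, fun z => ?_, fun z => ⟨fun hz => ?_, ?_⟩⟩
  · rw [← LinearMap.ker_eq_bot, LinearMap.ker_eq_bot']
    intro x hx
    obtain ⟨w, rfl⟩ := (h.exact x).1 (by rw [← hp, hx, map_zero])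
    rw [hb, map_eq_zero_iff _ h'.inj, map_eq_zero_iff _ ha.inj] at hx
    rw [hx, map_zero]
  · obtain ⟨y, rfl⟩ := ha.surj z
    exact ⟨i' y, hq y⟩
  · obtain ⟨x, hx⟩ := h.surj (p' z)
    obtain ⟨y, hy⟩ := (h'.exact (z - b x)).1 (by rw [map_sub, hp, hx, sub_self])
    have hy' : q y = 0 := by rw [← hq, hy, map_sub, hq', hz, sub_zero]
    obtain ⟨w, rfl⟩ := (ha.exact y).1 hy'
    exact ⟨x + i w, by rw [map_add, hb, hy, add_sub_cancel]⟩
  · rintro ⟨x, rfl⟩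
    exact hq' x

/-- In a morphism of short exact sequences that is the identity on the first terms, the
cokernel of the middle map is the cokernel of the last map. -/
theorem IsSES.cokernel_middle' {A B C B' C' Q : Type u} [AddCommGroup A] [Module R A]
    [AddCommGroup B] [Module R B] [AddCommGroup C] [Module R C] [AddCommGroup C'] [Module R C']
    [AddCommGroup B'] [Module R B'] [AddCommGroup Q] [Module R Q] {i : A →ₗ[R] B}
    {p : B →ₗ[R] C} {i' : A →ₗ[R] B'} {p' : B' →ₗ[R] C'} {c : C →ₗ[R] C'} {q : C' →ₗ[R] Q}
    {b : B →ₗ[R] B'} (h : IsSES i p) (h' : IsSES i' p') (hc : IsSES c q)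
    (hb : b ∘ₗ i = i') (hp : p' ∘ₗ b = c ∘ₗ p) : IsSES b (q ∘ₗ p') := by
  replace hb : ∀ x, b (i x) = i' x := fun x => congr($hb x)
  replace hp : ∀ x, p' (b x) = c (p x) := fun x => congr($hp x)
  refine ⟨?_, hc.surj.comp h'.surj, fun z => ⟨fun hz => ?_, ?_⟩⟩
  · rw [← LinearMap.ker_eq_bot, LinearMap.ker_eq_bot']
    intro x hx
    obtain ⟨w, rfl⟩ := (h.exact x).1 (hc.inj (by rw [← hp, hx, map_zero, map_zero]))
    rw [hb, map_eq_zero_iff _ h'.inj] at hx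
    rw [hx, map_zero]
  · obtain ⟨y, hy⟩ := (hc.exact _).1 hz
    obtain ⟨x, rfl⟩ := h.surj y
    obtain ⟨w, hw⟩ := (h'.exact (z - b x)).1 (by rw [map_sub, hp, hy, sub_self])
    exact ⟨x + i w, by rw [map_add, hb, hw, add_sub_cancel]⟩
  · rintro ⟨x, rfl⟩
    simp [hp, hc.apply_apply]

end LinearAlgebra

/-! ### Filtrations as iterated extensions, and additive closures -/

section Filtrations

variable {R : Type u} [Ring R]

theorem prop_of_equiv (P : ObjectProperty (ModuleCat.{u} R)) [P.IsClosedUnderIsomorphisms]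
    {X Y : ModuleCat.{u} R} (e : X ≃ₗ[R] Y) (h : P X) : P Y :=
  P.prop_of_iso e.toModuleIso h

theorem prop_of_nonempty_equiv (P : ObjectProperty (ModuleCat.{u} R))
    [P.IsClosedUnderIsomorphisms] {X Y : ModuleCat.{u} R} (e : Nonempty (X ≃ₗ[R] Y)) (h : P X) :
    P Y :=
  e.elim fun e => prop_of_equiv P e h

/-- The modules `X` that admit a short exact sequence `0 → A → X → C → 0` with `A` in `P` and `C`
in `Q`. -/
def star (P Q : ObjectProperty (ModuleCat.{u} R)) : ObjectProperty (ModuleCat.{u} R) := fun X =>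
  ∃ (A C : ModuleCat.{u} R) (i : A →ₗ[R] X) (p : X →ₗ[R] C), IsSES i p ∧ P A ∧ Q C

theorem nonempty_quotient_submoduleOf_equiv {X Q : Type u} [AddCommGroup X] [Module R X]
    [AddCommGroup Q] [Module R Q] {A B : Submodule R X} (f : B →ₗ[R] Q)
    (hf : Function.Surjective f) (h : ∀ x : B, f x = 0 ↔ x.1 ∈ A) :
    Nonempty ((B ⧸ A.submoduleOf B) ≃ₗ[R] Q) := by
  have : A.submoduleOf B = LinearMap.ker f := by
    ext x
    exact (h x).symm
  rw [this]
  exact ⟨f.quotKerEquivOfSurjective hf⟩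

variable {P : ObjectProperty (ModuleCat.{u} R)}

theorem filtered_zero_iff {X : ModuleCat.{u} R} : filtered P 0 X ↔ Subsingleton X := by
  constructor
  · rintro ⟨-, F, -, h0, h0', -⟩
    exact (Submodule.subsingleton_iff R).1 (subsingleton_of_bot_eq_top (h0'.symm.trans h0))
  · intro h
    exact ⟨inferInstance, fun _ => ⊤, fun _ _ _ => le_rfl, rfl, Subsingleton.elim _ _,
      fun i hi => absurd hi (Nat.not_lt_zero i)⟩

/-- The submodule `F 1` carries the shifted filtration, and `X / F 1` is the top factor. With its
converse below this turns filtrations into iterated extensions, on which the later inductions run.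
-/
theorem star_of_filtered_succ [IsNoetherianRing R] [P.IsClosedUnderIsomorphisms] {m : ℕ}
    {X : ModuleCat.{u} R} (h : filtered P (m + 1) X) : star (filtered P m) P X := by
  obtain ⟨hX, F, hF, h0, hm, h⟩ := h
  have : IsNoetherian R X := isNoetherian_of_isNoetherianRing_of_finite R X
  refine ⟨ModuleCat.of R (F 1), ModuleCat.of R (X ⧸ F 1), _, _, IsSES.subtype_mkQ (F 1),
    ⟨inferInstanceAs (Module.Finite R (F 1)), fun i => (F (i + 1)).submoduleOf (F 1),
      fun i j hij x hx => hF (Nat.add_le_add_right hij 1) hx,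
      Submodule.submoduleOf_self _, ?_, fun i hi => ?_⟩, ?_⟩
  · dsimp only
    rw [hm]
    ext x
    simp [Submodule.submoduleOf]
  · refine prop_of_nonempty_equiv P (Nonempty.map LinearEquiv.symm ?_) (h (i + 1) (by omega))
    have hle : F (i + 1) ≤ F 1 := hF (by omega)
    let g : ((F (i + 1)).submoduleOf (F 1)) →ₗ[R] F (i + 1) :=
      ((F 1).subtype ∘ₗ ((F (i + 1)).submoduleOf (F 1)).subtype).codRestrict _ fun x => x.2
    refine nonempty_quotient_submoduleOf_equiv
      (((F (i + 1 + 1)).submoduleOf (F (i + 1))).mkQ ∘ₗ g) ?_ ?_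
    · refine (Submodule.mkQ_surjective _).comp fun x => ⟨⟨⟨x.1, hle x.2⟩, x.2⟩, rfl⟩
    · intro x
      simp only [LinearMap.comp_apply, Submodule.mkQ_apply, Submodule.Quotient.mk_eq_zero]
      rfl
  · refine prop_of_nonempty_equiv P ?_ (h 0 (by omega))
    refine nonempty_quotient_submoduleOf_equiv ((F 1).mkQ ∘ₗ (F 0).subtype) ?_ ?_
    · intro y
      obtain ⟨x, rfl⟩ := (F 1).mkQ_surjective y
      exact ⟨⟨x, by rw [h0]; trivial⟩, rfl⟩
    · intro x
      simp

theorem filtered_succ_of_star [P.IsClosedUnderIsomorphisms]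
    (hP : ∀ X, P X → Module.Finite R X) {m : ℕ}
    {X : ModuleCat.{u} R} (h : star (filtered P m) P X) : filtered P (m + 1) X := by
  obtain ⟨A, C, i, p, hs, ⟨hA, F, hF, h0, hm, h⟩, hC⟩ := h
  have := hP C hC
  let G : ℕ → Submodule R X
    | 0 => ⊤
    | k + 1 => (F k).map i
  refine ⟨hs.finite_middle, G, ?_, rfl, ?_, fun k hk => ?_⟩
  · refine antitone_nat_of_succ_le fun k => ?_
    cases k with
    | zero => exact le_top
    | succ k => exact Submodule.map_mono (hF (Nat.le_succ k))
  · simp [G, hm]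
  · cases k with
    | zero =>
      refine prop_of_nonempty_equiv P (Nonempty.map LinearEquiv.symm ?_) hC
      refine nonempty_quotient_submoduleOf_equiv (p ∘ₗ (G 0).subtype)
        (fun y => ?_) fun x => ?_
      · obtain ⟨x, rfl⟩ := hs.surj y
        exact ⟨⟨x, trivial⟩, rfl⟩
      · simp [G, h0, hs.exact]
    | succ k =>
      refine prop_of_nonempty_equiv P ?_ (h k (by omega))
      let g : F k →ₗ[R] G (k + 1) :=
        (i ∘ₗ (F k).subtype).codRestrict _ fun x => ⟨x.1, x.2, rfl⟩
      refine nonempty_quotient_submoduleOf_equiv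
        (((G (k + 1 + 1)).submoduleOf (G (k + 1))).mkQ ∘ₗ g) ?_ ?_
      · refine (Submodule.mkQ_surjective _).comp ?_
        rintro ⟨_, x, hx, rfl⟩
        exact ⟨⟨x, hx⟩, rfl⟩
      · intro x
        simp only [LinearMap.comp_apply, Submodule.mkQ_apply, Submodule.Quotient.mk_eq_zero]
        change i x ∈ (F (k + 1)).map i ↔ _
        rw [← Submodule.mem_comap, Submodule.comap_map_eq_of_injective hs.inj]

theorem prop_pi (P : ObjectProperty (ModuleCat.{u} R)) [P.IsClosedUnderIsomorphisms]
    (h0 : P (ModuleCat.of R PUnit))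
    (hP : ∀ X Y, P X → P Y → P (ModuleCat.of R (X × Y))) {k : ℕ} (Y : Fin k → ModuleCat.{u} R)
    (hY : ∀ j, P (Y j)) : P (ModuleCat.of R (∀ j, Y j)) := by
  induction k with
  | zero =>
    exact prop_of_equiv P (X := ModuleCat.of R PUnit) (Y := ModuleCat.of R (∀ j, Y j))
      (LinearEquiv.ofSubsingleton _ _) h0
  | succ k ih =>
    exact prop_of_equiv P (X := ModuleCat.of R (Y 0 × ∀ j : Fin k, Y j.succ))
      (Y := ModuleCat.of R (∀ j, Y j)) (Fin.consLinearEquiv R (fun j => Y j))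
      (hP _ _ (hY 0) (ih _ fun j => hY _))

theorem filtered_succ_iff [IsNoetherianRing R] [P.IsClosedUnderIsomorphisms]
    (hP : ∀ X, P X → Module.Finite R X) {m : ℕ} {X : ModuleCat.{u} R} :
    filtered P (m + 1) X ↔ star (filtered P m) P X :=
  ⟨star_of_filtered_succ, filtered_succ_of_star hP⟩

theorem filtered_of_equiv [IsNoetherianRing R] [P.IsClosedUnderIsomorphisms]
    (hP : ∀ X, P X → Module.Finite R X) {m : ℕ} {X Y : ModuleCat.{u} R} (e : X ≃ₗ[R] Y)
    (h : filtered P m X) : filtered P m Y := by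
  cases m with
  | zero =>
    rw [filtered_zero_iff] at h ⊢
    exact e.symm.toEquiv.subsingleton
  | succ m =>
    rw [filtered_succ_iff hP] at h ⊢
    obtain ⟨A, C, i, p, hs, hA, hC⟩ := h
    exact ⟨A, C, _, _, hs.congr_middle e, hA, hC⟩

theorem filtered_isClosedUnderIsomorphisms [IsNoetherianRing R] [P.IsClosedUnderIsomorphisms]
    (hP : ∀ X, P X → Module.Finite R X) (m : ℕ) : (filtered P m).IsClosedUnderIsomorphisms where
  of_iso e h := filtered_of_equiv hP e.toLinearEquiv h

theorem filtered_prod [IsNoetherianRing R] [P.IsClosedUnderIsomorphisms]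
    (hP : ∀ X, P X → Module.Finite R X)
    (hprod : ∀ X Y, P X → P Y → P (ModuleCat.of R (X × Y))) {m : ℕ} (X Y : ModuleCat.{u} R)
    (hX : filtered P m X) (hY : filtered P m Y) : filtered P m (ModuleCat.of R (X × Y)) := by
  induction m generalizing X Y with
  | zero =>
    rw [filtered_zero_iff] at hX hY ⊢
    exact inferInstanceAs (Subsingleton (X × Y))
  | succ m ih =>
    rw [filtered_succ_iff hP] at hX hY ⊢
    obtain ⟨A, C, i, p, hs, hA, hC⟩ := hX
    obtain ⟨A', C', i', p', hs', hA', hC'⟩ := hY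
    exact ⟨_, _, _, _, hs.prodMap hs', ih _ _ hA hA', hprod _ _ hC hC'⟩

/-- Induction on `b`: the preimage in `X` of the submodule `B` of `C` is an extension of `B` by `A`,
and the quotient of `X` by it is the top factor of `C`. -/
theorem filtered_add_of_star [IsNoetherianRing R] [P.IsClosedUnderIsomorphisms]
    (hP : ∀ X, P X → Module.Finite R X) {a b : ℕ} {X : ModuleCat.{u} R}
    (h : star (filtered P a) (filtered P b) X) : filtered P (a + b) X := by
  induction b generalizing X with
  | zero =>
    obtain ⟨A, C, i, p, hs, hA, hC⟩ := h
    rw [filtered_zero_iff] at hC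
    have hi : Function.Surjective i := fun x => (hs.exact x).1 (Subsingleton.elim _ _)
    exact filtered_of_equiv hP (LinearEquiv.ofBijective i ⟨hs.inj, hi⟩) hA
  | succ b ih =>
    obtain ⟨A, C, i, p, hs, hA, hC⟩ := h
    rw [filtered_succ_iff hP] at hC
    obtain ⟨B, D, j, q, hs', hB, hD⟩ := hC
    obtain ⟨E, i', p', e, hE, h₁, h₂, -⟩ := exists_pullback hs j
    exact (filtered_succ_iff hP).2
      ⟨E, D, e, q ∘ₗ p, IsSES.cokernel_middle' hE hs hs' h₁ h₂, ih ⟨A, B, i', p', hE, hA, hB⟩, hD⟩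

theorem filtered_succ_of_filtered [IsNoetherianRing R] [P.IsClosedUnderIsomorphisms]
    (hP : ∀ X, P X → Module.Finite R X) (h0 : P (ModuleCat.of R PUnit)) {m : ℕ}
    {X : ModuleCat.{u} R} (h : filtered P m X) : filtered P (m + 1) X :=
  (filtered_succ_iff hP).2 ⟨X, ModuleCat.of R PUnit, _, _, IsSES.zero_right, h, h0⟩

theorem filtered_mono [IsNoetherianRing R] [P.IsClosedUnderIsomorphisms]
    (hP : ∀ X, P X → Module.Finite R X) (h0 : P (ModuleCat.of R PUnit)) {m m' : ℕ} (hm : m ≤ m')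
    {X : ModuleCat.{u} R} (h : filtered P m X) : filtered P m' X := by
  induction hm with
  | refl => exact h
  | step _ ih => exact filtered_succ_of_filtered hP h0 ih

theorem filtered_one [IsNoetherianRing R] [P.IsClosedUnderIsomorphisms]
    (hP : ∀ X, P X → Module.Finite R X) {X : ModuleCat.{u} R} (h : P X) : filtered P 1 X :=
  (filtered_succ_iff hP).2 ⟨ModuleCat.of R PUnit, X, _, _, IsSES.zero_left,
    filtered_zero_iff.2 inferInstance, h⟩

/-- `P` contains the direct summands of the modules in `P`. -/
def ClosedUnderSummands (P : ObjectProperty (ModuleCat.{u} R)) : Prop :=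
  ∀ ⦃X Y : ModuleCat.{u} R⦄ (i : X →ₗ[R] Y) (p : Y →ₗ[R] X), p ∘ₗ i = LinearMap.id → P Y → P X

theorem ClosedUnderSummands.isClosedUnderIsomorphisms (hP : ClosedUnderSummands P) :
    P.IsClosedUnderIsomorphisms where
  of_iso e h := hP e.inv.hom e.hom.hom (congrArg ModuleCat.Hom.hom e.inv_hom_id) h

theorem closedUnderSummands_addClosure (P : ObjectProperty (ModuleCat.{u} R)) :
    ClosedUnderSummands (addClosure P) := by
  rintro X Y i p hip ⟨k, Z, j, q, hZ, hjq⟩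
  refine ⟨k, Z, j ∘ₗ i, p ∘ₗ q, hZ, ?_⟩
  rw [LinearMap.comp_assoc, ← LinearMap.comp_assoc i j q, hjq, LinearMap.id_comp, hip]

theorem addClosure_of_prop {X : ModuleCat.{u} R} (h : P X) : addClosure P X :=
  ⟨1, fun _ => X, LinearMap.pi fun _ => LinearMap.id, LinearMap.proj 0, fun _ => h, rfl⟩

theorem addClosure_iff [P.IsClosedUnderIsomorphisms] (h0 : P (ModuleCat.of R PUnit))
    (hP : ∀ X Y, P X → P Y → P (ModuleCat.of R (X × Y))) {X : ModuleCat.{u} R} :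
    addClosure P X ↔ ∃ (Y : ModuleCat.{u} R) (i : X →ₗ[R] Y) (p : Y →ₗ[R] X),
      P Y ∧ p ∘ₗ i = LinearMap.id := by
  constructor
  · rintro ⟨k, Y, i, p, hY, hip⟩
    exact ⟨ModuleCat.of R (∀ j, Y j), i, p, prop_pi P h0 hP Y hY, hip⟩
  · rintro ⟨Y, i, p, hY, hip⟩
    exact closedUnderSummands_addClosure P i p hip (addClosure_of_prop hY)

/-- A module that is an extension of a direct summand `X₃` of `Y₃` by a direct summand `X₁` of `Y₁`
is a direct summand of an extension of `Y₃` by `Y₁`. -/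
theorem IsSES.exists_summand {X₁ X₂ X₃ Y₁ Y₃ : ModuleCat.{u} R} {i : X₁ →ₗ[R] X₂}
    {p : X₂ →ₗ[R] X₃} (h : IsSES i p) {i₁ : X₁ →ₗ[R] Y₁} {p₁ : Y₁ →ₗ[R] X₁} {i₃ : X₃ →ₗ[R] Y₃}
    {p₃ : Y₃ →ₗ[R] X₃} (h₁ : p₁ ∘ₗ i₁ = LinearMap.id) (h₃ : p₃ ∘ₗ i₃ = LinearMap.id) :
    ∃ (Y₂ : ModuleCat.{u} R) (j : Y₁ →ₗ[R] Y₂) (q : Y₂ →ₗ[R] Y₃) (i₂ : X₂ →ₗ[R] Y₂)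
      (p₂ : Y₂ →ₗ[R] X₂), IsSES j q ∧ p₂ ∘ₗ i₂ = LinearMap.id := by
  -- The retraction `p₁` of `i₁` makes `X₂` a summand of the pushout `Z`; dually, the section `i₃`
  -- of `p₃` makes `Z` a summand of its pullback `Y₂`.
  obtain ⟨Z, j, q, b, hZ, hqb, hbi, hk⟩ := exists_pushout h i₁
  obtain ⟨s, hs, -⟩ := hk X₂ LinearMap.id (i ∘ₗ p₁) (by
    rw [LinearMap.id_comp, LinearMap.comp_assoc, h₁, LinearMap.comp_id])
  obtain ⟨Y₂, j', q', b', hY, -, hqb', hk'⟩ := exists_pullback hZ p₃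
  obtain ⟨t, ht, -⟩ := hk' Z LinearMap.id (i₃ ∘ₗ q) (by
    rw [LinearMap.comp_id, ← LinearMap.comp_assoc, h₃, LinearMap.id_comp])
  refine ⟨Y₂, j', q', t ∘ₗ b, s ∘ₗ b', hY, ?_⟩
  rw [LinearMap.comp_assoc, ← LinearMap.comp_assoc b t b', ht, LinearMap.id_comp, hs]

end Filtrations

/-! ### Finitely generated injective modules by coinduction from the field -/

section Coinduced

variable (K : Type*) [Field K] (R : Type u) [Ring R] [Algebra K R] (V : Type u) [AddCommGroup V]
  [Module K V]

/-- The coinduced module `Hom_K(R, V)`. -/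
structure Coinduced where
  /-- the underlying `K`-linear map -/
  toHom : R →ₗ[K] V

namespace Coinduced

variable {K R V}

/-- The coinduced module consists of the `K`-linear maps `R → V`. -/
def equivHom : Coinduced K R V ≃ (R →ₗ[K] V) := ⟨toHom, mk, fun _ => rfl, fun _ => rfl⟩

instance : AddCommGroup (Coinduced K R V) := equivHom.addCommGroup

instance : Module K (Coinduced K R V) := equivHom.module K

theorem toHom_add (f g : Coinduced K R V) : (f + g).toHom = f.toHom + g.toHom := rfl

theorem toHom_zero : (0 : Coinduced K R V).toHom = 0 := rfl

-- The wrapper keeps this action on arguments apart from the action on values, which is also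
-- conceivable when `V` is an `R`-module, as in the embedding below.
instance : SMul R (Coinduced K R V) := ⟨fun r f => ⟨f.toHom ∘ₗ LinearMap.mulRight K r⟩⟩

theorem toHom_smul (r : R) (f : Coinduced K R V) (x : R) : (r • f).toHom x = f.toHom (x * r) :=
  rfl

@[ext]
theorem ext {f g : Coinduced K R V} (h : ∀ x, f.toHom x = g.toHom x) : f = g :=
  equivHom.injective (LinearMap.ext h)

instance : Module R (Coinduced K R V) where
  one_smul f := by ext; simp [toHom_smul]
  mul_smul r s f := by ext; simp [toHom_smul, mul_assoc]
  smul_zero r := by ext; simp [toHom_smul, toHom_zero]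
  smul_add r f g := by ext; simp [toHom_smul, toHom_add]
  add_smul r s f := by ext; simp [toHom_smul, toHom_add, mul_add]
  zero_smul f := by ext; simp [toHom_smul, toHom_zero]

instance : IsScalarTower K R (Coinduced K R V) where
  smul_assoc k r f := by
    ext x
    change f.toHom (x * (k • r)) = k • f.toHom (x * r)
    simp

instance [Module.Finite K R] [Module.Finite K V] : Module.Finite R (Coinduced K R V) := by
  have : Module.Finite K (Coinduced K R V) :=
    Module.Finite.equiv (equivHom.linearEquiv K (α := Coinduced K R V)).symm
  exact Module.Finite.of_restrictScalars_finite K R _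

/-- Maps `X → Hom_K(R, V)` over `R` correspond to `K`-linear maps `X → V` by evaluation at `1`, and
the latter extend along `f` because `f` has a `K`-linear left inverse. -/
instance injective : Module.Injective R (Coinduced K R V) where
  out X Y _ _ _ _ f hf g := by
    let := Module.compHom X (algebraMap K R)
    let := Module.compHom Y (algebraMap K R)
    have hX : ∀ (k : K) (x : X), k • x = algebraMap K R k • x := fun _ _ => rfl
    have hY : ∀ (k : K) (x : Y), k • x = algebraMap K R k • x := fun _ _ => rfl
    let f' : X →ₗ[K] Y :=
      { toFun := f
        map_add' := f.map_add
        map_smul' := fun k x => by simp [hX, hY] }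
    let g' : X →ₗ[K] V :=
      { toFun := fun x => (g x).toHom 1
        map_add' := fun x y => by simp [toHom_add]
        map_smul' := fun k x => by
          rw [hX, g.map_smul, toHom_smul, one_mul, Algebra.algebraMap_eq_smul_one, map_smul]
          rfl }
    obtain ⟨s, hs⟩ := f'.exists_leftInverse_of_injective (LinearMap.ker_eq_bot.2 hf)
    have hs' : ∀ x, s (f x) = x := fun x => congr($hs x)
    refine ⟨{ toFun := fun y => ⟨{ toFun := fun r => g' (s (r • y))
                                   map_add' := fun a b => by simp [add_smul]
                                   map_smul' := fun k r => ?_ }⟩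
              map_add' := fun a b => ?_
              map_smul' := fun r y => ?_ }, fun x => ?_⟩
    · have : (k • r) • y = k • r • y := by rw [hY, smul_smul, Algebra.smul_def]
      simp [this]
    · ext r
      simp [toHom_add]
    · ext r
      simp [toHom_smul, mul_smul]
    · ext r
      have : s (r • f x) = r • x := by rw [← map_smul, hs']
      change g' (s (r • f x)) = _
      rw [this]
      simp [g', toHom_smul]

end Coinduced

/-- Finitely generated modules embed into finitely generated injective modules. -/
class HasFiniteInjectiveEmbeddings (R : Type u) [Ring R] : Prop where
  exists_embedding : ∀ M : ModuleCat.{u} R, Module.Finite R M → ∃ (I : ModuleCat.{u} R)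
    (f : M →ₗ[R] I), Module.Finite R I ∧ Module.Injective R I ∧ Function.Injective f

theorem hasFiniteInjectiveEmbeddings_of_finite [Module.Finite K R] :
    HasFiniteInjectiveEmbeddings R where
  exists_embedding M hM := by
    let := Module.compHom M (algebraMap K R)
    have : IsScalarTower K R M := .of_algebraMap_smul fun _ _ => rfl
    have : Module.Finite K M := Module.Finite.trans R M
    refine ⟨ModuleCat.of R (Coinduced K R M),
      { toFun := fun m => ⟨(LinearMap.toSpanSingleton R M m).restrictScalars K⟩
        map_add' := fun a b => ?_
        map_smul' := fun a b => ?_ }, inferInstanceAs (Module.Finite R (Coinduced K R M)),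
        inferInstanceAs (Module.Injective R (Coinduced K R M)), fun a b hab => ?_⟩
    · ext r
      simp [Coinduced.toHom_add]
    · ext r
      simp [Coinduced.toHom_smul, mul_smul]
    · simpa using congr(($hab).toHom 1)

end Coinduced

/-! ### Minimal left approximations -/

section LeftApproximations

variable {R : Type u} [Ring R] {P : ObjectProperty (ModuleCat.{u} R)}

/-- `f : M → C` is a left `P`-approximation of `M`. -/
def IsLeftApprox (P : ObjectProperty (ModuleCat.{u} R)) {M C : ModuleCat.{u} R}
    (f : M →ₗ[R] C) : Prop :=
  P C ∧ ∀ (D : ModuleCat.{u} R) (g : M →ₗ[R] D), P D → ∃ h : C →ₗ[R] D, h ∘ₗ f = g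

theorem covariantlyFinite_iff : CovariantlyFinite P ↔ ∀ M : ModuleCat.{u} R, Module.Finite R M →
    ∃ (C : ModuleCat.{u} R) (f : M →ₗ[R] C), IsLeftApprox P f := by
  refine forall₂_congr fun M _ => exists_congr fun C => ⟨?_, ?_⟩
  · rintro ⟨f, hC, h⟩
    refine ⟨f.hom, hC, fun D g hD => ?_⟩
    obtain ⟨k, hk⟩ := h D (ModuleCat.ofHom g) hD
    exact ⟨k.hom, congrArg ModuleCat.Hom.hom hk⟩
  · rintro ⟨f, hC, h⟩
    refine ⟨ModuleCat.ofHom f, hC, fun D g hD => ?_⟩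
    obtain ⟨k, hk⟩ := h D g.hom hD
    exact ⟨ModuleCat.ofHom k, ModuleCat.hom_ext hk⟩

/-- `f : M → C` is a left minimal left `P`-approximation of `M`. -/
structure IsMinimalLeftApprox (P : ObjectProperty (ModuleCat.{u} R)) {M C : ModuleCat.{u} R}
    (f : M →ₗ[R] C) : Prop where
  approx : IsLeftApprox P f
  minimal : ∀ φ : C →ₗ[R] C, φ ∘ₗ f = f → Function.Bijective φ

theorem pow_comp_eq {M C : ModuleCat.{u} R} {f : M →ₗ[R] C} {φ : C →ₗ[R] C} (h : φ ∘ₗ f = f)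
    (n : ℕ) : (φ ^ n) ∘ₗ f = f := by
  induction n with
  | zero => rfl
  | succ n ih => rw [pow_succ, Module.End.mul_eq_comp, LinearMap.comp_assoc, h, ih]

/-- An approximation whose target has least length is minimal: if `φ` fixes `f`, Fitting's lemma
makes the image of a power of `φ` a summand through which `f` still approximates, so that image is
everything. -/
theorem exists_minimalLeftApprox [IsArtinianRing R] (hP : ∀ X, P X → Module.Finite R X)
    (hs : ClosedUnderSummands P) {M : ModuleCat.{u} R}
    (h : ∃ (C : ModuleCat.{u} R) (f : M →ₗ[R] C), IsLeftApprox P f) :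
    ∃ (C : ModuleCat.{u} R) (f : M →ₗ[R] C), IsMinimalLeftApprox P f := by
  let S : Set ℕ∞ := {l | ∃ (C : ModuleCat.{u} R) (f : M →ₗ[R] C), IsLeftApprox P f ∧
    Module.length R C = l}
  have hS : S.Nonempty := by
    obtain ⟨C, f, hf⟩ := h
    exact ⟨_, C, f, hf, rfl⟩
  obtain ⟨C, f, hf, hl⟩ := WellFounded.min_mem (wellFounded_lt (α := ℕ∞)) S hS
  refine ⟨C, f, hf, fun φ hφ => ?_⟩
  have := hP C hf.1
  -- The exponent has to be positive, since surjectivity of `φ ^ n` is later used to get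
  -- surjectivity of `φ`.
  obtain ⟨n, hn, hn0⟩ := (φ.eventually_isCompl_ker_pow_range_pow.and
    (Filter.eventually_gt_atTop 0)).exists
  have hfn := pow_comp_eq hφ n
  let C' : ModuleCat.{u} R := ModuleCat.of R (LinearMap.range (φ ^ n))
  let p : C →ₗ[R] C' := Submodule.projectionOnto _ _ hn.symm
  have hp : ∀ x : C', p x.1 = x := fun x => Submodule.projectionOnto_apply_left hn.symm x
  have hC' : P C' := hs (LinearMap.range (φ ^ n)).subtype p (LinearMap.ext hp) hf.1
  have hf' : IsLeftApprox P (M := M) (C := C') (f.codRestrict (LinearMap.range (φ ^ n))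
      fun x => ⟨f x, congr($hfn x)⟩) := by
    refine ⟨hC', fun D g hD => ?_⟩
    obtain ⟨k, rfl⟩ := hf.2 D g hD
    exact ⟨k ∘ₗ (LinearMap.range (φ ^ n)).subtype, rfl⟩
  have htop : LinearMap.range (φ ^ n) = ⊤ := by
    by_contra hne
    have hlt := Submodule.length_lt hne
    rw [hl] at hlt
    exact WellFounded.not_lt_min (wellFounded_lt (α := ℕ∞)) (s := S) ⟨C', _, hf', rfl⟩ hlt
  have hsurj : Function.Surjective φ := by
    intro x
    obtain ⟨y, hy⟩ : x ∈ LinearMap.range (φ ^ n) := htop ▸ trivial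
    obtain ⟨m, rfl⟩ := Nat.exists_eq_succ_of_ne_zero hn0.ne'
    exact ⟨(φ ^ m) y, by rw [← hy, pow_succ']; rfl⟩
  have : IsNoetherian R C := inferInstance
  exact IsNoetherian.bijective_of_surjective_endomorphism φ hsurj

/-- The target of a minimal approximation is a direct summand of the target of any approximation. -/
theorem IsMinimalLeftApprox.exists_summand {M C C' : ModuleCat.{u} R} {f : M →ₗ[R] C}
    (hf : IsMinimalLeftApprox P f) {f' : M →ₗ[R] C'} (hf' : IsLeftApprox P f') :
    ∃ (i : C →ₗ[R] C') (p : C' →ₗ[R] C), p ∘ₗ i = LinearMap.id ∧ i ∘ₗ f = f' := by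
  obtain ⟨i, hi⟩ := hf.approx.2 C' f' hf'.1
  obtain ⟨q, hq⟩ := hf'.2 C f hf.approx.1
  let e := LinearEquiv.ofBijective (q ∘ₗ i) (hf.minimal _ (by
    rw [LinearMap.comp_assoc, hi, hq]))
  refine ⟨i, e.symm.toLinearMap ∘ₗ q, ?_, hi⟩
  ext x
  exact e.symm_apply_apply x

end LeftApproximations

/-! ### Injective envelopes -/

section InjectiveModules

variable {R : Type u} [Ring R]

theorem _root_.Module.Injective.exists_extend {I X Y : ModuleCat.{u} R} (hI : Module.Injective R I)
    {f : X →ₗ[R] Y} (hf : Function.Injective f) (g : X →ₗ[R] I) : ∃ h : Y →ₗ[R] I, h ∘ₗ f = g := by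
  obtain ⟨h, hh⟩ := hI.out f hf g
  exact ⟨h, LinearMap.ext hh⟩

/-- The finitely generated injective modules. -/
def finiteInjectives (R : Type u) [Ring R] : ObjectProperty (ModuleCat.{u} R) := fun I =>
  Module.Finite R I ∧ Module.Injective R I

theorem closedUnderSummands_finiteInjectives : ClosedUnderSummands (finiteInjectives R) := by
  rintro X Y i p hip ⟨hY, hY'⟩
  have hp : Function.Surjective p := fun x => ⟨i x, congr($hip x)⟩
  refine ⟨Module.Finite.of_surjective p hp, ⟨fun A B _ _ _ _ f hf g => ?_⟩⟩
  obtain ⟨h, hh⟩ := hY'.out f hf (i ∘ₗ g)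
  refine ⟨p ∘ₗ h, fun x => ?_⟩
  rw [LinearMap.comp_apply, hh]
  exact congr($hip (g x))

theorem finiteInjectives_prod {X Y : ModuleCat.{u} R} (hX : finiteInjectives R X)
    (hY : finiteInjectives R Y) : finiteInjectives R (ModuleCat.of R (X × Y)) := by
  obtain ⟨hX, hX'⟩ := hX
  obtain ⟨hY, hY'⟩ := hY
  refine ⟨inferInstanceAs (Module.Finite R (X × Y)), ⟨fun A B _ _ _ _ f hf g => ?_⟩⟩
  obtain ⟨h, hh⟩ := hX'.out f hf (LinearMap.fst R X Y ∘ₗ g)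
  obtain ⟨k, hk⟩ := hY'.out f hf (LinearMap.snd R X Y ∘ₗ g)
  exact ⟨h.prod k, fun x => Prod.ext (hh x) (hk x)⟩

theorem finiteInjectives_of_subsingleton {X : ModuleCat.{u} R} [Subsingleton X] :
    finiteInjectives R X :=
  ⟨inferInstance, ⟨fun _ _ _ _ _ _ _ _ _ => ⟨0, fun _ => Subsingleton.elim _ _⟩⟩⟩

/-- The envelope is a minimal left approximation by injectives. If `N` meets the image of `M`
trivially, `M` embeds into `E / N`, and extending `f` along this embedding gives an endomorphism of
`E` that fixes `f` and kills `N`; minimality forces `N = 0`. -/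
theorem exists_isInjectiveEnvelope [IsArtinianRing R] [HasFiniteInjectiveEmbeddings R]
    {M : ModuleCat.{u} R} (hM : Module.Finite R M) :
    ∃ (I : ModuleCat.{u} R) (f : M ⟶ I), IsInjectiveEnvelope f := by
  obtain ⟨I, g, hI, hI', hg⟩ := HasFiniteInjectiveEmbeddings.exists_embedding M hM
  obtain ⟨E, f, hf⟩ := exists_minimalLeftApprox (P := finiteInjectives R) (fun _ h => h.1)
    closedUnderSummands_finiteInjectives (M := M)
    ⟨I, g, ⟨hI, hI'⟩, fun D k hD => hD.2.exists_extend hg k⟩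
  obtain ⟨h, hh⟩ := hf.approx.2 I g ⟨hI, hI'⟩
  have hinj : Function.Injective f := by
    rw [← hh] at hg
    exact Function.Injective.of_comp hg
  refine ⟨E, ModuleCat.ofHom f, hf.approx.1.1, hf.approx.1.2, hinj, fun N hN => ?_⟩
  have hker : Function.Injective (N.mkQ ∘ₗ f) := by
    rw [← LinearMap.ker_eq_bot, LinearMap.ker_eq_bot']
    intro m hm
    rw [LinearMap.comp_apply, Submodule.mkQ_apply, Submodule.Quotient.mk_eq_zero] at hm
    have : f m ∈ N ⊓ LinearMap.range f := ⟨hm, m, rfl⟩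
    rw [show N ⊓ LinearMap.range f = ⊥ from hN, Submodule.mem_bot] at this
    exact (map_eq_zero_iff f hinj).1 this
  obtain ⟨k, hk⟩ := hf.approx.1.2.exists_extend (Y := ModuleCat.of R (E ⧸ N)) hker f
  have := (hf.minimal (k ∘ₗ N.mkQ) hk).1
  rw [Submodule.eq_bot_iff]
  intro x hx
  refine this ?_
  rw [map_zero, LinearMap.comp_apply, Submodule.mkQ_apply, (Submodule.Quotient.mk_eq_zero N).2 hx,
    map_zero]

/-- Any embedding into a finitely generated injective module is the direct sum of an injective
envelope and an injective module. -/
theorem IsInjectiveEnvelope.exists_equiv_prod [IsArtinianRing R] {M E I : ModuleCat.{u} R}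
    {f : M ⟶ E} (hf : IsInjectiveEnvelope f) {g : M →ₗ[R] I} (hg : Function.Injective g)
    (hI : finiteInjectives R I) : ∃ (E' : ModuleCat.{u} R) (e : I ≃ₗ[R] E × E'),
      finiteInjectives R E' ∧ e.toLinearMap ∘ₗ g = LinearMap.inl R E E' ∘ₗ f.hom := by
  have := hf.finite
  obtain ⟨a, ha⟩ := hI.2.exists_extend hf.injective_hom g
  obtain ⟨b, hb⟩ := hf.injective.exists_extend hg f.hom
  have hba : (b ∘ₗ a) ∘ₗ f.hom = f.hom := by rw [LinearMap.comp_assoc, ha, hb]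
  -- The kernel of `b ∘ a` meets the image of `M` trivially, so it vanishes by essentiality; finite
  -- length then makes `b ∘ a` bijective. The complement `E'` is the kernel of the resulting
  -- retraction `c`.
  have hinj : Function.Injective (b ∘ₗ a) := by
    rw [← LinearMap.ker_eq_bot]
    refine hf.essential _ ?_
    rw [Submodule.eq_bot_iff]
    rintro _ ⟨hx, m, rfl⟩
    have : (b ∘ₗ a) (f.hom m) = f.hom m := congr($hba m)
    rw [← this]
    exact hx
  let θ := LinearEquiv.ofBijective (b ∘ₗ a)
    (IsArtinian.bijective_of_injective_endomorphism _ hinj)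
  let c := θ.symm.toLinearMap ∘ₗ b
  have hca : ∀ x, c (a x) = x := fun x => θ.symm_apply_apply x
  have hcg : ∀ x, c (g x) = f.hom x := fun x => by
    rw [← ha]
    exact hca _
  let r : I →ₗ[R] LinearMap.ker c := (LinearMap.id - a ∘ₗ c).codRestrict _ fun x => by
    simp [hca]
  refine ⟨ModuleCat.of R (LinearMap.ker c),
    LinearEquiv.ofLinearMap (c.prod r) (a.coprod (LinearMap.ker c).subtype) ?_ ?_, ?_, ?_⟩
  · refine LinearMap.ext fun x => ?_
    obtain ⟨x, y⟩ := x
    refine Prod.ext ?_ (Subtype.ext ?_) <;> simp [r, hca]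
  · ext x
    simp [r]
  · refine closedUnderSummands_finiteInjectives (LinearMap.ker c).subtype r ?_ hI
    ext x
    simp [r]
  · refine LinearMap.ext fun x => Prod.ext (hcg x) (Subtype.ext ?_)
    change g x - a (c (g x)) = 0
    rw [hcg, ← ha]
    simp

end InjectiveModules

/-! ### Cosyzygies without minimality -/

section Cosyzygies

variable {R : Type u} [Ring R]

theorem IsSES.nonempty_equiv_right {A B C C' : Type u} [AddCommGroup A] [Module R A]
    [AddCommGroup B] [Module R B] [AddCommGroup C] [Module R C] [AddCommGroup C'] [Module R C']
    {i : A →ₗ[R] B} {p : B →ₗ[R] C} {p' : B →ₗ[R] C'} (h : IsSES i p) (h' : IsSES i p') :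
    Nonempty (C ≃ₗ[R] C') :=
  ⟨h.nonempty_equiv_quotient.some.symm.trans h'.nonempty_equiv_quotient.some⟩

theorem IsSES.inl_comp {A B C D : Type u} [AddCommGroup A] [Module R A] [AddCommGroup B]
    [Module R B] [AddCommGroup C] [Module R C] [AddCommGroup D] [Module R D] {i : A →ₗ[R] B}
    {p : B →ₗ[R] C} (h : IsSES i p) :
    IsSES (LinearMap.inl R B D ∘ₗ i) (p.prodMap (LinearMap.id : D →ₗ[R] D)) where
  inj := LinearMap.inl_injective.comp h.inj
  surj := h.surj.prodMap Function.surjective_id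
  exact x := by
    obtain ⟨b, d⟩ := x
    simp [h.exact, eq_comm (a := (0 : D))]

theorem IsCosyzygy.finite {n : ℕ} {C Z : ModuleCat.{u} R} (h : IsCosyzygy n C Z)
    (hC : Module.Finite R C) : Module.Finite R Z := by
  induction n generalizing C with
  | zero => exact Module.Finite.equiv h.some.symm
  | succ n ih =>
    obtain ⟨I, f, hf, h⟩ := h
    have := hf.finite
    exact ih h (inferInstanceAs (Module.Finite R (I ⧸ LinearMap.range f.hom)))

/-- The definition peels off the first step of the resolution; this lemma and the next one give
access to the last step. -/
theorem IsCosyzygy.succ {n : ℕ} {C Z E : ModuleCat.{u} R} (h : IsCosyzygy n C Z) {g : Z ⟶ E}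
    (hg : IsInjectiveEnvelope g) :
    IsCosyzygy (n + 1) C (ModuleCat.of R (E ⧸ LinearMap.range g.hom)) := by
  induction n generalizing C with
  | zero =>
    obtain ⟨e⟩ := h
    have hrange : LinearMap.range (g.hom ∘ₗ e.symm.toLinearMap) = LinearMap.range g.hom :=
      LinearMap.range_comp_of_range_eq_top _ e.symm.range
    refine ⟨E, ModuleCat.ofHom (g.hom ∘ₗ e.symm.toLinearMap), ⟨hg.finite, hg.injective,
      hg.injective_hom.comp e.symm.injective, fun N hN => hg.essential N ?_⟩,
      ⟨Submodule.quotEquivOfEq _ _ hrange.symm⟩⟩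
    rwa [ModuleCat.hom_ofHom, hrange] at hN
  | succ n ih =>
    obtain ⟨I, f, hf, h⟩ := h
    exact ⟨I, f, hf, ih h⟩

theorem IsCosyzygy.exists_of_succ {n : ℕ} {C Z : ModuleCat.{u} R} (h : IsCosyzygy (n + 1) C Z) :
    ∃ (Z' E : ModuleCat.{u} R) (g : Z' ⟶ E), IsCosyzygy n C Z' ∧ IsInjectiveEnvelope g ∧
      Nonempty (Z ≃ₗ[R] E ⧸ LinearMap.range g.hom) := by
  induction n generalizing C with
  | zero =>
    obtain ⟨I, f, hf, h⟩ := h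
    exact ⟨C, I, f, ⟨LinearEquiv.refl R C⟩, hf, h⟩
  | succ n ih =>
    obtain ⟨I, f, hf, h⟩ := h
    obtain ⟨Z', E, g, hZ', hg, e⟩ := ih h
    exact ⟨Z', E, g, ⟨I, f, hf, hZ'⟩, hg, e⟩

instance (n : ℕ) : (cosyzygies R n).IsClosedUnderIsomorphisms where
  of_iso e := by
    rintro ⟨C, Z, I, hC, hZ, hI, hI', ⟨e'⟩⟩
    exact ⟨C, Z, I, hC, hZ, hI, hI', ⟨e.toLinearEquiv.symm.trans e'⟩⟩

theorem finite_of_cosyzygies {n : ℕ} (X : ModuleCat.{u} R) (h : cosyzygies R n X) :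
    Module.Finite R X := by
  obtain ⟨C, Z, I, hC, hZ, hI, hI', ⟨e⟩⟩ := h
  have := hZ.finite hC
  exact Module.Finite.equiv e.symm

theorem cosyzygies_of_isCosyzygy {n : ℕ} {C Z : ModuleCat.{u} R} (h : IsCosyzygy n C Z)
    (hC : Module.Finite R C) : cosyzygies R n Z :=
  have hI := finiteInjectives_of_subsingleton (R := R) (X := ModuleCat.of R PUnit.{u + 1})
  ⟨C, Z, ModuleCat.of R PUnit.{u + 1}, hC, h, hI.1, hI.2, ⟨LinearEquiv.prodUnique.symm⟩⟩

theorem cosyzygies_zero_iff {X : ModuleCat.{u} R} : cosyzygies R 0 X ↔ Module.Finite R X :=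
  ⟨finite_of_cosyzygies X, fun h =>
    cosyzygies_of_isCosyzygy (n := 0) ⟨LinearEquiv.refl R X⟩ h⟩

theorem exists_isSES_of_cosyzygies_succ {n : ℕ} {X : ModuleCat.{u} R}
    (h : cosyzygies R (n + 1) X) : ∃ (B I : ModuleCat.{u} R) (i : B →ₗ[R] I) (p : I →ₗ[R] X),
      IsSES i p ∧ cosyzygies R n B ∧ finiteInjectives R I := by
  obtain ⟨C, Z, J, hC, hZ, hJ, hJ', ⟨e⟩⟩ := h
  obtain ⟨Z', E, g, hZ', hg, ⟨e'⟩⟩ := hZ.exists_of_succ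
  have hs := ((IsSES.of_injective hg.injective_hom).inl_comp (D := J)).congr_right
    ((LinearEquiv.prodCongr e'.symm (LinearEquiv.refl R J)).trans e.symm)
  exact ⟨Z', ModuleCat.of R (E × J), _, _, hs, cosyzygies_of_isCosyzygy hZ' hC,
    finiteInjectives_prod ⟨hg.finite, hg.injective⟩ ⟨hJ, hJ'⟩⟩

/-- Together with the previous lemma: up to injective summands, one step is the cokernel of any
embedding into a finitely generated injective, so envelopes are not needed afterwards. The injective
part `J` of `B` splits off `I`, and the remaining embedding of `Z` is an envelope plus an injective
complement. -/
theorem cosyzygies_succ_of_isSES [IsArtinianRing R] [HasFiniteInjectiveEmbeddings R] {n : ℕ}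
    {B I X : ModuleCat.{u} R} {i : B →ₗ[R] I} {p : I →ₗ[R] X} (hs : IsSES i p)
    (hB : cosyzygies R n B) (hI : finiteInjectives R I) : cosyzygies R (n + 1) X := by
  obtain ⟨C, Z, J, hC, hZ, hJ, hJ', ⟨e⟩⟩ := hB
  have hZfin := hZ.finite hC
  -- The map `r` retracts `I` onto the copy `j` of `J`, so `ker r` is a complement; it is injective
  -- and contains the image of `Z`.
  obtain ⟨r, hr⟩ := hJ'.exists_extend hs.inj (LinearMap.snd R Z J ∘ₗ e.toLinearMap)
  replace hr : ∀ b, r (i b) = (e b).2 := fun b => congr($hr b)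
  let j : J →ₗ[R] I := i ∘ₗ e.symm.toLinearMap ∘ₗ LinearMap.inr R Z J
  have hrj : ∀ x, r (j x) = x := fun x => by simp [j, hr]
  have hpj : ∀ x, p (j x) = 0 := fun x => hs.apply_apply _
  let I₁ : ModuleCat.{u} R := ModuleCat.of R (LinearMap.ker r)
  let s : I →ₗ[R] I₁ := (LinearMap.id - j ∘ₗ r).codRestrict _ fun x => by simp [hrj]
  have hs' : ∀ x, (s x).1 = x - j (r x) := fun _ => rfl
  have hI₁ : finiteInjectives R I₁ :=
    closedUnderSummands_finiteInjectives (X := I₁) (LinearMap.ker r).subtype s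
      (LinearMap.ext fun x => Subtype.ext (by
        change x.1 - j (r x.1) = x.1
        rw [LinearMap.mem_ker.1 x.2, map_zero, sub_zero])) hI
  let z : Z →ₗ[R] I₁ := (i ∘ₗ e.symm.toLinearMap ∘ₗ LinearMap.inl R Z J).codRestrict _ fun x => by
    simp [hr]
  have hz : IsSES z (p ∘ₗ (LinearMap.ker r).subtype) := by
    refine ⟨fun x y hxy => ?_, fun x => ?_, fun x => ⟨fun hx => ?_, ?_⟩⟩
    · have := hs.inj congr(($hxy).1)
      simpa using this
    · obtain ⟨y, rfl⟩ := hs.surj x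
      exact ⟨s y, by rw [LinearMap.comp_apply, Submodule.subtype_apply, hs', map_sub, hpj, sub_zero]⟩
    · obtain ⟨b, hb⟩ := (hs.exact x.1).1 hx
      have h2 : (e b).2 = 0 := by rw [← hr, hb]; exact x.2
      refine ⟨(e b).1, Subtype.ext ?_⟩
      have : ((e b).1, (0 : J)) = e b := by rw [← h2]
      change i (e.symm ((e b).1, 0)) = x.1
      rw [this, e.symm_apply_apply, hb]
    · rintro ⟨y, rfl⟩
      exact hs.apply_apply _
  obtain ⟨E, f, hf⟩ := exists_isInjectiveEnvelope hZfin
  obtain ⟨E', e', hE', hg⟩ := hf.exists_equiv_prod hz.inj hI₁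
  have h₁ := hz.congr_middle e'
  have h₂ := (IsSES.of_injective hf.injective_hom).inl_comp (D := E')
  rw [← hg] at h₂
  exact ⟨C, _, E', hC, hZ.succ hf, hE'.1, hE'.2, h₁.nonempty_equiv_right h₂⟩

theorem cosyzygies_of_subsingleton [IsArtinianRing R] [HasFiniteInjectiveEmbeddings R] (n : ℕ) :
    cosyzygies R n (ModuleCat.of R PUnit.{u + 1}) := by
  induction n with
  | zero => exact cosyzygies_zero_iff.2 (inferInstanceAs (Module.Finite R PUnit.{u + 1}))
  | succ n ih =>
    exact cosyzygies_succ_of_isSES IsSES.zero_right ih finiteInjectives_of_subsingleton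

theorem cosyzygies_prod [IsArtinianRing R] [HasFiniteInjectiveEmbeddings R] {n : ℕ}
    (X Y : ModuleCat.{u} R) (hX : cosyzygies R n X) (hY : cosyzygies R n Y) :
    cosyzygies R n (ModuleCat.of R (X × Y)) := by
  induction n generalizing X Y with
  | zero =>
    rw [cosyzygies_zero_iff] at hX hY ⊢
    exact inferInstanceAs (Module.Finite R (X × Y))
  | succ n ih =>
    obtain ⟨B, I, i, p, hs, hB, hI⟩ := exists_isSES_of_cosyzygies_succ hX
    obtain ⟨B', I', i', p', hs', hB', hI'⟩ := exists_isSES_of_cosyzygies_succ hY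
    exact cosyzygies_succ_of_isSES (B := ModuleCat.of R (B × B')) (I := ModuleCat.of R (I × I'))
      (hs.prodMap hs') (ih _ _ hB hB') (finiteInjectives_prod hI hI')

theorem cosyzygies_of_finiteInjectives [IsArtinianRing R] [HasFiniteInjectiveEmbeddings R] {n : ℕ}
    {I : ModuleCat.{u} R} (hI : finiteInjectives R I) : cosyzygies R n I := by
  cases n with
  | zero => exact cosyzygies_zero_iff.2 hI.1
  | succ n =>
    exact cosyzygies_succ_of_isSES (B := ModuleCat.of R PUnit.{u + 1}) IsSES.zero_left
      (cosyzygies_of_subsingleton n) hI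

end Cosyzygies

/-! ### Covariant finiteness of each level -/

section CovariantFiniteness

variable {R : Type u} [Ring R] {P Q : ObjectProperty (ModuleCat.{u} R)}

theorem exists_free_cover {M : ModuleCat.{u} R} (hM : Module.Finite R M) :
    ∃ (F : ModuleCat.{u} R) (f : F →ₗ[R] M), Module.Finite R F ∧ Module.Projective R F ∧
      Function.Surjective f := by
  obtain ⟨k, f, hf⟩ := Module.Finite.exists_fin' R M
  exact ⟨ModuleCat.of R (Fin k → R), f, inferInstanceAs (Module.Finite R (Fin k → R)),
    inferInstanceAs (Module.Projective R (Fin k → R)), hf⟩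

/-- The kernel of a surjection `M ⊕ F → C` extending a `Q`-approximation of `M` is approximated in
`P`; pushing out along that gives the approximation of `M`. -/
theorem covariantlyFinite_star [IsNoetherianRing R] (hQ : ∀ X, Q X → Module.Finite R X)
    (hP : CovariantlyFinite P) (hQ' : CovariantlyFinite Q) : CovariantlyFinite (star P Q) := by
  rw [covariantlyFinite_iff] at *
  intro M hM
  obtain ⟨C, c, hC, hc⟩ := hQ' M hM
  obtain ⟨F, π, hF, hF', hπ⟩ := exists_free_cover (hQ C hC)
  -- The approximation `c` need not be onto; the free summand `F` repairs this, and maps out of `F`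
  -- lift by projectivity when the approximation is tested.
  have hsurj : Function.Surjective (c.coprod π) := fun x => by
    obtain ⟨y, rfl⟩ := hπ x
    exact ⟨(0, y), by simp⟩
  have hs := IsSES.of_surjective hsurj
  obtain ⟨A, a, hA, ha⟩ := hP (ModuleCat.of R (LinearMap.ker (c.coprod π))) hs.finite_left
  obtain ⟨X, i, p, b, hX, hpb, hbi, hk⟩ := exists_pushout hs a
  refine ⟨X, b ∘ₗ LinearMap.inl R M F, ⟨A, C, i, p, hX, hA, hC⟩, ?_⟩
  rintro D g ⟨A', C', i', p', hD, hA', hC'⟩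
  obtain ⟨γ, hγ⟩ := hc C' (p' ∘ₗ g) hC'
  obtain ⟨t, ht⟩ := Module.projective_lifting_property p' (γ ∘ₗ π) hD.surj
  have hgt : p' ∘ₗ g.coprod t = γ ∘ₗ c.coprod π := by
    rw [LinearMap.comp_coprod, LinearMap.comp_coprod, ht, hγ]
  obtain ⟨l, hl⟩ := hD.exists_lift (g.coprod t ∘ₗ (LinearMap.ker (c.coprod π)).subtype) (by
    rw [← LinearMap.comp_assoc, hgt, LinearMap.comp_assoc, hs.comp_eq_zero, LinearMap.comp_zero])
  obtain ⟨m, hm⟩ := ha A' l hA'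
  obtain ⟨k, hkb, -⟩ := hk D (g.coprod t) (i' ∘ₗ m) (by
    rw [← hl, LinearMap.comp_assoc]
    exact congrArg _ hm.symm)
  exact ⟨k, by rw [← LinearMap.comp_assoc, hkb, LinearMap.coprod_inl]⟩

theorem covariantlyFinite_filtered [IsNoetherianRing R] [P.IsClosedUnderIsomorphisms]
    (hP : ∀ X, P X → Module.Finite R X) (h : CovariantlyFinite P) (m : ℕ) :
    CovariantlyFinite (filtered P m) := by
  induction m with
  | zero =>
    rw [covariantlyFinite_iff]
    refine fun M _ => ⟨ModuleCat.of R PUnit, 0, filtered_zero_iff.2 inferInstance, fun D g hD => ?_⟩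
    have := filtered_zero_iff.1 hD
    exact ⟨0, LinearMap.ext fun _ => Subsingleton.elim _ _⟩
  | succ m ih =>
    have : filtered P (m + 1) = star (filtered P m) P := by
      ext X
      exact filtered_succ_iff hP
    rw [this]
    exact covariantlyFinite_star hP ih h

theorem covariantlyFinite_addClosure (h : CovariantlyFinite P) :
    CovariantlyFinite (addClosure P) := by
  rw [covariantlyFinite_iff] at *
  intro M hM
  obtain ⟨C, c, hC, hc⟩ := h M hM
  refine ⟨C, c, addClosure_of_prop hC, ?_⟩
  rintro D g ⟨k, Y, i, p, hY, hip⟩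
  choose f hf using fun j => hc (Y j) (LinearMap.proj j ∘ₗ i ∘ₗ g) (hY j)
  refine ⟨p ∘ₗ LinearMap.pi f, ?_⟩
  have : LinearMap.pi f ∘ₗ c = i ∘ₗ g := by
    ext x j
    exact congr($(hf j) x)
  rw [LinearMap.comp_assoc, this, ← LinearMap.comp_assoc, hip, LinearMap.id_comp]

/-- Approximate the syzygy of `M` by `L` in the previous class, form the pushout `E` and embed it
into an injective `I`. The induced map `M = E / L → I / L` is the approximation: a map from `M` to
`D = J / B` lifts to one between the presentations. -/
theorem covariantlyFinite_cosyzygies [IsArtinianRing R] [HasFiniteInjectiveEmbeddings R] (n : ℕ) :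
    CovariantlyFinite (cosyzygies R n) := by
  rw [covariantlyFinite_iff]
  induction n with
  | zero =>
    intro M hM
    exact ⟨M, LinearMap.id, cosyzygies_zero_iff.2 hM, fun D g _ => ⟨g, rfl⟩⟩
  | succ n ih =>
    intro M hM
    obtain ⟨F, π, hF, hF', hπ⟩ := exists_free_cover hM
    have hs := IsSES.of_surjective hπ
    obtain ⟨L, a, hL, ha⟩ := ih (ModuleCat.of R (LinearMap.ker π)) hs.finite_left
    have hLfin := finite_of_cosyzygies L hL
    obtain ⟨E, i, p, b, hE, hpb, hbi, hk⟩ := exists_pushout hs a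
    obtain ⟨I, f, hI, hI', hf⟩ := HasFiniteInjectiveEmbeddings.exists_embedding E hE.finite_middle
    have hs₁ := IsSES.of_injective (f := f ∘ₗ i) (hf.comp hE.inj)
    obtain ⟨c, hc⟩ := hE.exists_desc ((LinearMap.range (f ∘ₗ i)).mkQ ∘ₗ f) (by
      rw [LinearMap.comp_assoc, hs₁.comp_eq_zero])
    refine ⟨ModuleCat.of R (I ⧸ LinearMap.range (f ∘ₗ i)), c,
      cosyzygies_succ_of_isSES hs₁ hL ⟨hI, hI'⟩, fun D g hD => ?_⟩
    obtain ⟨B, J, j, q, hs₂, hB, hJ⟩ := exists_isSES_of_cosyzygies_succ hD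
    obtain ⟨t, ht⟩ := Module.projective_lifting_property q (g ∘ₗ π) hs₂.surj
    obtain ⟨l, hl⟩ := hs₂.exists_lift (t ∘ₗ (LinearMap.ker π).subtype) (by
      rw [← LinearMap.comp_assoc, ht, LinearMap.comp_assoc, hs.comp_eq_zero, LinearMap.comp_zero])
    obtain ⟨m, hm⟩ := ha B l hB
    obtain ⟨k, hkb, hki⟩ := hk J t (j ∘ₗ m) (by
      rw [← hl, LinearMap.comp_assoc]
      exact congrArg _ hm.symm)
    obtain ⟨v, hv⟩ := hJ.2.exists_extend hf k
    obtain ⟨w, hw⟩ := hs₁.exists_desc (q ∘ₗ v) (by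
      rw [LinearMap.comp_assoc, ← LinearMap.comp_assoc i f v, hv, hki, ← LinearMap.comp_assoc,
        hs₂.comp_eq_zero, LinearMap.zero_comp])
    refine ⟨w, ?_⟩
    have hcπ : c ∘ₗ π = (LinearMap.range (f ∘ₗ i)).mkQ ∘ₗ f ∘ₗ b := by
      rw [← hpb, ← LinearMap.comp_assoc, hc, LinearMap.comp_assoc]
    refine LinearMap.ext fun x => ?_
    obtain ⟨y, rfl⟩ := hπ x
    have h₁ : w (c (π y)) = q (t y) := by
      rw [show c (π y) = (LinearMap.range (f ∘ₗ i)).mkQ (f (b y)) from congr($hcπ y),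
        show w ((LinearMap.range (f ∘ₗ i)).mkQ (f (b y))) = q (v (f (b y))) from congr($hw _),
        show v (f (b y)) = k (b y) from congr($hv _), show k (b y) = t y from congr($hkb y)]
    exact h₁.trans congr($ht y)

theorem covariantlyFinite_yLevel [IsArtinianRing R] [HasFiniteInjectiveEmbeddings R] (n m : ℕ) :
    CovariantlyFinite (yLevel R n m) :=
  covariantlyFinite_addClosure
    (covariantlyFinite_filtered finite_of_cosyzygies (covariantlyFinite_cosyzygies n) m)

end CovariantFiniteness

/-! ### Levels, their union, and closure under extensions -/

section Levels

variable {R : Type u} [Ring R] [IsArtinianRing R] [HasFiniteInjectiveEmbeddings R] {n : ℕ}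

theorem yLevel_iff {m : ℕ} {X : ModuleCat.{u} R} : yLevel R n m X ↔
    ∃ (Y : ModuleCat.{u} R) (i : X →ₗ[R] Y) (p : Y →ₗ[R] X),
      filtered (cosyzygies R n) m Y ∧ p ∘ₗ i = LinearMap.id :=
  have := filtered_isClosedUnderIsomorphisms (finite_of_cosyzygies (R := R) (n := n)) m
  addClosure_iff (filtered_mono finite_of_cosyzygies (cosyzygies_of_subsingleton n) m.zero_le
    (filtered_zero_iff.2 inferInstance)) (filtered_prod finite_of_cosyzygies cosyzygies_prod)

theorem finite_of_yLevel {m : ℕ} (X : ModuleCat.{u} R) (h : yLevel R n m X) :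
    Module.Finite R X := by
  obtain ⟨Y, i, p, hY, hip⟩ := yLevel_iff.1 h
  have := hY.1
  exact Module.Finite.of_surjective p fun x => ⟨i x, congr($hip x)⟩

omit [IsArtinianRing R] [HasFiniteInjectiveEmbeddings R] in
theorem closedUnderSummands_yLevel (m : ℕ) : ClosedUnderSummands (yLevel R n m) :=
  closedUnderSummands_addClosure _

theorem yLevel_add {a b : ℕ} {X : ModuleCat.{u} R}
    (h : star (yLevel R n a) (yLevel R n b) X) : yLevel R n (a + b) X := by
  obtain ⟨A, C, i, p, hs, hA, hC⟩ := h
  obtain ⟨A', iA, pA, hA', hiA⟩ := yLevel_iff.1 hA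
  obtain ⟨C', iC, pC, hC', hiC⟩ := yLevel_iff.1 hC
  obtain ⟨Y, j, q, i₂, p₂, hY, h₂⟩ := hs.exists_summand hiA hiC
  exact yLevel_iff.2 ⟨Y, i₂, p₂,
    filtered_add_of_star finite_of_cosyzygies ⟨A', C', j, q, hY, hA', hC'⟩, h₂⟩

theorem yLevel_mono {m m' : ℕ} (h : m ≤ m') {X : ModuleCat.{u} R} (hX : yLevel R n m X) :
    yLevel R n m' X := by
  obtain ⟨Y, i, p, hY, hip⟩ := yLevel_iff.1 hX
  exact yLevel_iff.2 ⟨Y, i, p,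
    filtered_mono finite_of_cosyzygies (cosyzygies_of_subsingleton n) h hY, hip⟩

omit [HasFiniteInjectiveEmbeddings R] in
theorem yLevel_one_of_cosyzygies {X : ModuleCat.{u} R} (h : cosyzygies R n X) :
    yLevel R n 1 X :=
  addClosure_of_prop (filtered_one finite_of_cosyzygies h)

theorem yLevel_prod {m : ℕ} (X Y : ModuleCat.{u} R) (hX : yLevel R n m X) (hY : yLevel R n m Y) :
    yLevel R n m (ModuleCat.of R (X × Y)) := by
  obtain ⟨X', i, p, hX', hip⟩ := yLevel_iff.1 hX
  obtain ⟨Y', j, q, hY', hjq⟩ := yLevel_iff.1 hY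
  refine yLevel_iff.2 ⟨ModuleCat.of R (X' × Y'), i.prodMap j, p.prodMap q,
    filtered_prod finite_of_cosyzygies cosyzygies_prod _ _ hX' hY', ?_⟩
  rw [LinearMap.prodMap_comp, hip, hjq, LinearMap.prodMap_id]

theorem finite_of_yUnion (X : ModuleCat.{u} R) (h : yUnion R n X) : Module.Finite R X :=
  finite_of_yLevel X h.choose_spec

omit [IsArtinianRing R] [HasFiniteInjectiveEmbeddings R] in
theorem closedUnderSummands_yUnion : ClosedUnderSummands (yUnion R n) :=
  fun _ _ i p hip ⟨m, h⟩ => ⟨m, closedUnderSummands_yLevel m i p hip h⟩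

theorem yUnion_of_star {X : ModuleCat.{u} R} (h : star (yUnion R n) (yUnion R n) X) :
    yUnion R n X := by
  obtain ⟨A, C, i, p, hs, ⟨a, hA⟩, ⟨b, hC⟩⟩ := h
  exact ⟨a + b, yLevel_add ⟨A, C, i, p, hs, hA, hC⟩⟩

theorem yUnion_of_finiteInjectives {I : ModuleCat.{u} R} (h : finiteInjectives R I) :
    yUnion R n I :=
  ⟨1, yLevel_one_of_cosyzygies (cosyzygies_of_finiteInjectives h)⟩

/-- If some positive level is closed under extensions, then it is the union of all levels. -/
theorem yUnion_eq_of_isClosedUnderExtensions {m : ℕ} (hm : 0 < m)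
    (h : (yLevel R n m).IsClosedUnderExtensions) : yUnion R n = yLevel R n m := by
  have key : ∀ (k : ℕ) (X : ModuleCat.{u} R), filtered (cosyzygies R n) k X → yLevel R n m X := by
    intro k
    induction k with
    | zero =>
      intro X hX
      exact addClosure_of_prop (filtered_mono finite_of_cosyzygies (cosyzygies_of_subsingleton n)
        m.zero_le hX)
    | succ k ih =>
      intro X hX
      obtain ⟨A, C, i, p, hs, hA, hC⟩ := star_of_filtered_succ hX
      -- The top factor has level `1`, hence level `m` because `0 < m`.
      exact h.prop_X₂_of_shortExact hs.shortExact (ih A hA)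
        (yLevel_mono hm (yLevel_one_of_cosyzygies hC))
  ext X
  refine ⟨?_, fun hX => ⟨m, hX⟩⟩
  rintro ⟨k, hX⟩
  obtain ⟨Y, i, p, hY, hip⟩ := yLevel_iff.1 hX
  exact closedUnderSummands_yLevel m i p hip (key k Y hY)

theorem isClosedUnderExtensions_of_yUnion_eq {m : ℕ} (h : yUnion R n = yLevel R n m) :
    (yLevel R n m).IsClosedUnderExtensions := by
  rw [← h]
  exact ⟨fun {S} hS h₁ h₃ => yUnion_of_star ⟨S.X₁, S.X₃, _, _, IsSES.of_shortExact hS, h₁, h₃⟩⟩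

end Levels

/-! ### Ext orthogonality and Wakamatsu's lemma -/

section ExtVanishing

open Abelian

variable {R : Type u} [Ring R]

theorem projective_of_module {F : ModuleCat.{u} R} (hF : Module.Projective R F) : Projective F :=
  (IsProjective.iff_projective F).1 hF

theorem ext_eq_zero_of_finiteInjectives {Q I : ModuleCat.{u} R} (hI : finiteInjectives R I) {i : ℕ}
    (hi : 1 ≤ i) (e : Ext Q I i) : e = 0 := by
  have := hI.2
  have : Injective I := Module.injective_object_of_injective_module R I
  obtain ⟨i, rfl⟩ := Nat.exists_eq_add_of_le' hi
  exact e.eq_zero_of_injective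

/-- A map into the last term of a short exact sequence lifts to the middle term. -/
theorem IsSES.exists_lift_of_ext {A B C Q : ModuleCat.{u} R} {i : A →ₗ[R] B} {p : B →ₗ[R] C}
    (h : IsSES i p) (hQ : ∀ e : Ext Q A 1, e = 0) (g : Q →ₗ[R] C) :
    ∃ k : Q →ₗ[R] B, p ∘ₗ k = g := by
  obtain ⟨x, hx⟩ := Ext.covariant_sequence_exact₃ Q h.shortExact
    (Ext.mk₀ (ModuleCat.ofHom g)) (zero_add 1) (hQ _)
  obtain ⟨φ, rfl⟩ := Ext.homEquiv₀.symm.surjective x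
  refine ⟨φ.hom, ?_⟩
  have : φ ≫ ModuleCat.ofHom p = ModuleCat.ofHom g :=
    Ext.homEquiv₀.symm.injective (by simpa using hx)
  exact congrArg ModuleCat.Hom.hom this

/-- A map out of the first term of a short exact sequence extends to the middle term. -/
theorem IsSES.exists_extend_of_ext {A B C D : ModuleCat.{u} R} {i : A →ₗ[R] B} {p : B →ₗ[R] C}
    (h : IsSES i p) (hD : ∀ e : Ext C D 1, e = 0) (g : A →ₗ[R] D) :
    ∃ k : B →ₗ[R] D, k ∘ₗ i = g := by
  obtain ⟨x, hx⟩ := Ext.contravariant_sequence_exact₁ h.shortExact D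
    (Ext.mk₀ (ModuleCat.ofHom g)) (add_zero 1) (hD _)
  obtain ⟨φ, rfl⟩ := Ext.homEquiv₀.symm.surjective x
  refine ⟨φ.hom, ?_⟩
  have : ModuleCat.ofHom i ≫ φ = ModuleCat.ofHom g :=
    Ext.homEquiv₀.symm.injective (by simpa using hx)
  exact congrArg ModuleCat.Hom.hom this

/-- As `F` is projective, `Ext¹(Q, D)` is the cokernel of restriction `Hom(F, D) → Hom(K, D)`. -/
theorem IsSES.ext_eq_zero_of_extends {K F Q D : ModuleCat.{u} R} {i : K →ₗ[R] F}
    {p : F →ₗ[R] Q} (h : IsSES i p) (hF : Module.Projective R F)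
    (hD : ∀ g : K →ₗ[R] D, ∃ k : F →ₗ[R] D, k ∘ₗ i = g) (e : Ext Q D 1) : e = 0 := by
  have := projective_of_module hF
  obtain ⟨x, rfl⟩ := Ext.contravariant_sequence_exact₃ h.shortExact D e
    (Ext.eq_zero_of_projective _) (add_zero 1)
  obtain ⟨φ, rfl⟩ := Ext.homEquiv₀.symm.surjective x
  obtain ⟨k, hk⟩ := hD φ.hom
  have : φ = ModuleCat.ofHom i ≫ ModuleCat.ofHom k := ModuleCat.hom_ext hk.symm
  subst this
  rw [Ext.homEquiv₀_symm_apply, ← Ext.mk₀_comp_mk₀]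
  exact h.shortExact.extClass_comp_assoc _

theorem ext_eq_zero_of_star {Q X : ModuleCat.{u} R} {P : ObjectProperty (ModuleCat.{u} R)} {i : ℕ}
    (hP : ∀ Y, P Y → ∀ e : Ext Q Y i, e = 0) {P' : ObjectProperty (ModuleCat.{u} R)}
    (hP' : ∀ Y, P' Y → ∀ e : Ext Q Y i, e = 0) (hX : star P P' X) (e : Ext Q X i) : e = 0 := by
  obtain ⟨A, C, j, p, hs, hA, hC⟩ := hX
  obtain ⟨x, rfl⟩ := Ext.covariant_sequence_exact₂ Q hs.shortExact e (hP' C hC _)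
  rw [hP A hA x, Ext.zero_comp]

theorem ext_eq_zero_of_summand {Q X Y : ModuleCat.{u} R} {i : ℕ} (h : ∀ e : Ext Q Y i, e = 0)
    {j : X →ₗ[R] Y} {p : Y →ₗ[R] X} (hjp : p ∘ₗ j = LinearMap.id) (e : Ext Q X i) : e = 0 := by
  have : ModuleCat.ofHom j ≫ ModuleCat.ofHom p = 𝟙 X := ModuleCat.hom_ext hjp
  rw [← e.comp_mk₀_id, ← this, ← Ext.mk₀_comp_mk₀, ← Ext.comp_assoc_of_third_deg_zero,
    h (e.comp _ _), Ext.zero_comp]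

/-- Each step back along `0 → B → I → X → 0` trades one unit of `k` for one of `i`, so `i + k` stays
above the projective dimension. -/
theorem ext_eq_zero_of_cosyzygies {Q : ModuleCat.{u} R} {N : ℕ} (hQ : HasProjectiveDimensionLE Q N)
    {k : ℕ} {X : ModuleCat.{u} R} (hX : cosyzygies R k X) {i : ℕ} (hi : 1 ≤ i) (hN : N < i + k)
    (e : Ext Q X i) : e = 0 := by
  induction k generalizing X i with
  | zero => exact e.eq_zero_of_hasProjectiveDimensionLT (N + 1) hN
  | succ k ih =>
    obtain ⟨B, I, j, p, hs, hB, hI⟩ := exists_isSES_of_cosyzygies_succ hX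
    obtain ⟨x, rfl⟩ := Ext.covariant_sequence_exact₃ Q hs.shortExact e rfl
      (ih hB (by omega) (by omega) _)
    rw [ext_eq_zero_of_finiteInjectives hI hi x, Ext.zero_comp]

variable [IsArtinianRing R] [HasFiniteInjectiveEmbeddings R]

theorem ext_eq_zero_of_yUnion {n : ℕ} {Q : ModuleCat.{u} R} (hQ : HasProjectiveDimensionLE Q n)
    {X : ModuleCat.{u} R} (hX : yUnion R n X) {i : ℕ} (hi : 1 ≤ i) (e : Ext Q X i) : e = 0 := by
  obtain ⟨m, hX⟩ := hX
  obtain ⟨Y, j, p, hY, hjp⟩ := yLevel_iff.1 hX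
  refine ext_eq_zero_of_summand ?_ hjp e
  clear hX hjp j p e X
  induction m generalizing Y with
  | zero =>
    have := filtered_zero_iff.1 hY
    exact ext_eq_zero_of_finiteInjectives finiteInjectives_of_subsingleton hi
  | succ m ih =>
    exact ext_eq_zero_of_star ih
      (fun Y hY => ext_eq_zero_of_cosyzygies hQ hY hi (by omega)) (star_of_filtered_succ hY)

/-- The shift in the other direction: `Extᵏ⁺¹(Q, B)` is a quotient of `Extᵏ(Q, I / B)`, and `I / B`
lies one cosyzygy class further on. -/
theorem ext_eq_zero_of_finite_of_cosyzygies {n k : ℕ} (hk : 1 ≤ k) {Q : ModuleCat.{u} R}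
    (hQ : ∀ X, cosyzygies R n X → ∀ e : Ext Q X k, e = 0) {C : ModuleCat.{u} R}
    (hC : Module.Finite R C) (e : Ext Q C (k + n)) : e = 0 := by
  induction n generalizing k with
  | zero => exact hQ C (cosyzygies_zero_iff.2 hC) e
  | succ n ih =>
    have hkn : k + 1 + n = k + (n + 1) := by omega
    revert e
    rw [← hkn]
    refine fun e => ih (by omega) (fun B hB e => ?_) e
    obtain ⟨I, f, hI, hI', hf⟩ := HasFiniteInjectiveEmbeddings.exists_embedding B
      (finite_of_cosyzygies B hB)
    have hs := IsSES.of_injective hf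
    obtain ⟨x, rfl⟩ := Ext.covariant_sequence_exact₁ Q hs.shortExact e
      (ext_eq_zero_of_finiteInjectives ⟨hI, hI'⟩ (by omega) _) rfl
    rw [hQ _ (cosyzygies_succ_of_isSES (X := ModuleCat.of R (I ⧸ LinearMap.range f)) hs hB
      ⟨hI, hI'⟩) x, Ext.zero_comp]

-- Finitely generated test modules suffice because the syzygies of `Q` are finitely generated; in
-- degree one, testing on `ker π` already splits the cover `π`.
omit [HasFiniteInjectiveEmbeddings R] in
theorem hasProjectiveDimensionLE_of_ext {n : ℕ} {Q : ModuleCat.{u} R} (hQ : Module.Finite R Q)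
    (h : ∀ C : ModuleCat.{u} R, Module.Finite R C → ∀ e : Ext Q C (n + 1), e = 0) :
    HasProjectiveDimensionLE Q n := by
  induction n generalizing Q with
  | zero =>
    obtain ⟨F, π, hF, hF', hπ⟩ := exists_free_cover hQ
    have hs := IsSES.of_surjective hπ
    obtain ⟨k, hk⟩ := IsSES.exists_lift_of_ext (A := ModuleCat.of R (LinearMap.ker π)) hs
      (h _ hs.finite_left) LinearMap.id
    exact (projective_iff_hasProjectiveDimensionLE_zero Q).1
      (projective_of_module (Module.Projective.of_split k π hk))
  | succ n ih =>
    obtain ⟨F, π, hF, hF', hπ⟩ := exists_free_cover hQ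
    have hs := IsSES.of_surjective hπ
    have := projective_of_module hF'
    refine (hs.shortExact.hasProjectiveDimensionLT_X₃_iff n this).2
      (ih (Q := ModuleCat.of R (LinearMap.ker π)) hs.finite_left fun C hC e => ?_)
    obtain ⟨x, rfl⟩ := Ext.contravariant_sequence_exact₁ hs.shortExact C e (add_comm _ _)
      (h C hC _)
    rw [x.eq_zero_of_projective, Ext.comp_zero]

omit [IsArtinianRing R] [HasFiniteInjectiveEmbeddings R] in
/-- Wakamatsu's lemma. -/
theorem IsMinimalLeftApprox.ext_cokernel_eq_zero {P : ObjectProperty (ModuleCat.{u} R)}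
    (hP : ∀ X, star P P X → P X) {M C Q : ModuleCat.{u} R} {f : M →ₗ[R] C}
    (hf : IsMinimalLeftApprox P f) {q : C →ₗ[R] Q} (hs : IsSES f q) (hQ : Module.Finite R Q)
    {D : ModuleCat.{u} R} (hD : P D) (e : Ext Q D 1) : e = 0 := by
  obtain ⟨F, π, hF, hF', hπ⟩ := exists_free_cover hQ
  have hK := IsSES.of_surjective hπ
  refine IsSES.ext_eq_zero_of_extends (K := ModuleCat.of R (LinearMap.ker π)) hK hF'
    (fun l => ?_) e
  -- The map `l` extends to `F` once the extension `E` of `Q` by `D` splits. Its pullback `E'` along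
  -- `q` is an extension of `C` by `D`, hence in `P`.
  obtain ⟨E, i, p, b, hE, hpb, hbi, -⟩ := exists_pushout hK l
  obtain ⟨E', i', p', c, hE', hci, hpc, hk⟩ := exists_pullback hE q
  -- The lift `m` of `f` to `E'` factors as `h ∘ f`, and by minimality `p' ∘ h` is an automorphism
  -- `φ` fixing `f`. As `c ∘ m = 0`, the map `c ∘ h ∘ φ⁻¹` descends to a section `t` of `p`.
  obtain ⟨m, hcm, hpm⟩ := hk M 0 f (by rw [hs.comp_eq_zero, LinearMap.comp_zero])
  obtain ⟨h, hh⟩ := hf.approx.2 E' m (hP E' ⟨D, C, i', p', hE', hD, hf.approx.1⟩)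
  have hφ : (p' ∘ₗ h) ∘ₗ f = f := by rw [LinearMap.comp_assoc, hh, hpm]
  let φ := LinearEquiv.ofBijective (p' ∘ₗ h) (hf.minimal _ hφ)
  have hφf : ∀ x, φ.symm (f x) = f x := fun x => by
    rw [LinearEquiv.symm_apply_eq]
    exact congr($hφ x).symm
  obtain ⟨t, ht⟩ := hs.exists_desc (c ∘ₗ h ∘ₗ φ.symm.toLinearMap) (by
    ext x
    have h₁ : h (f x) = m x := congr($hh x)
    have h₂ : c (m x) = 0 := congr($hcm x)
    simp [hφf, h₁, h₂])
  have hpt : ∀ y, p (t y) = y := fun y => by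
    obtain ⟨x, rfl⟩ := hs.surj y
    rw [show t (q x) = c (h (φ.symm x)) from congr($ht x),
      show p (c (h (φ.symm x))) = q (p' (h (φ.symm x))) from congr($hpc _)]
    exact congrArg q (φ.apply_symm_apply x)
  obtain ⟨ρ, hρ⟩ := hE.exists_lift (LinearMap.id - t ∘ₗ p) (by
    ext x
    simp [hpt])
  refine ⟨ρ ∘ₗ b, LinearMap.ext fun x => hE.inj ?_⟩
  have hρ' : ∀ y, i (ρ y) = y - t (p y) := fun y => congr($hρ y)
  have hbi' : b x.1 = i (l x) := congr($hbi x)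
  change i (ρ (b x.1)) = i (l x)
  rw [hbi', hρ', hE.apply_apply, map_zero, sub_zero]

end ExtVanishing

/-! ### Special embeddings and a uniform bound on the level -/

section SpecialApproximations

open Abelian

variable {R : Type u} [Ring R]

/-- The cokernel of a composition of two monomorphisms is an extension of their cokernels. -/
theorem IsSES.exists_comp {A B C Q Q' : ModuleCat.{u} R} {f : A →ₗ[R] B} {q : B →ₗ[R] Q}
    {g : B →ₗ[R] C} {r : C →ₗ[R] Q'} (hf : IsSES f q) (hg : IsSES g r) :
    ∃ (T : ModuleCat.{u} R) (s : C →ₗ[R] T) (i : Q →ₗ[R] T) (p : T →ₗ[R] Q'),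
      IsSES (g ∘ₗ f) s ∧ IsSES i p := by
  obtain ⟨T, i, p, s, hT, hps, hsg, -⟩ := exists_pushout hg q
  replace hps : ∀ x, p (s x) = r x := fun x => congr($hps x)
  replace hsg : ∀ x, s (g x) = i (q x) := fun x => congr($hsg x)
  refine ⟨T, s, i, p, ⟨hg.inj.comp hf.inj, fun z => ?_, fun x => ⟨fun hx => ?_, ?_⟩⟩, hT⟩
  · obtain ⟨x, hx⟩ := hg.surj (p z)
    obtain ⟨y, hy⟩ := (hT.exact (z - s x)).1 (by rw [map_sub, hps, hx, sub_self])
    obtain ⟨w, rfl⟩ := hf.surj y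
    exact ⟨x + g w, by rw [map_add, hsg, hy, add_sub_cancel]⟩
  · obtain ⟨y, rfl⟩ := (hg.exact x).1 (by rw [← hps, hx, map_zero])
    rw [hsg, map_eq_zero_iff _ hT.inj] at hx
    obtain ⟨w, rfl⟩ := (hf.exact y).1 hx
    exact ⟨w, rfl⟩
  · rintro ⟨w, rfl⟩
    simp [hsg, hf.apply_apply]

/-- Modules killed by the Jacobson radical are direct summands of powers of `R / J`. -/
theorem exists_summand_pi_quotient_jacobson [IsArtinianRing R] {M : ModuleCat.{u} R}
    (hM : Module.Finite R M) (hJ : ∀ r ∈ Ring.jacobson R, ∀ x : M, r • x = 0) :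
    ∃ (k : ℕ) (i : M →ₗ[R] (Fin k → R ⧸ Ring.jacobson R))
      (p : (Fin k → R ⧸ Ring.jacobson R) →ₗ[R] M), p ∘ₗ i = LinearMap.id := by
  obtain ⟨k, f, hf⟩ := Module.Finite.exists_fin' R M
  let g : Fin k → (R ⧸ Ring.jacobson R) →ₗ[R] M := fun j =>
    (Ring.jacobson R).liftQ (f ∘ₗ LinearMap.single R (fun _ => R) j) fun r hr => by
      have : (Pi.single j r : Fin k → R) = r • Pi.single j 1 := by
        rw [← Pi.single_smul, smul_eq_mul, mul_one]
      simp [this, hJ r hr]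
  let p : (Fin k → R ⧸ Ring.jacobson R) →ₗ[R] M := ∑ j, g j ∘ₗ LinearMap.proj j
  have hp : Function.Surjective p := fun x => by
    obtain ⟨y, rfl⟩ := hf x
    refine ⟨fun j => (Ring.jacobson R).mkQ (y j), ?_⟩
    have hy : f y = ∑ j, f (Pi.single j (y j)) := by
      rw [← map_sum, Finset.univ_sum_single]
    have hg : ∀ j (r : R), g j ((Ring.jacobson R).mkQ r) = f (Pi.single j r) := fun _ _ => rfl
    simp only [p, LinearMap.sum_apply, LinearMap.comp_apply, LinearMap.proj_apply, hg, hy]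
  have ht : Module.IsTorsionBySet R (R ⧸ Ring.jacobson R) (Ring.jacobson R) :=
    Module.isTorsionBySet_quotient_iff _ _ |>.2 fun m r hr =>
      Ideal.mul_mem_right _ _ hr
  -- Semisimplicity over the ring `R / J` carries over to `R`, because `J` is two-sided and
  -- annihilates the module.
  have : IsSemisimpleModule R (R ⧸ Ring.jacobson R) := by
    let := ht.module
    exact (ht.semilinearMap.isSemisimpleModule_iff_of_bijective Function.bijective_id).2
      inferInstance
  obtain ⟨i, hi⟩ := IsSemisimpleModule.lifting_property p hp LinearMap.id
  exact ⟨k, i, p, hi⟩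

variable {n : ℕ}

/-- `M` embeds into a module of level `m` with cokernel of projective dimension at most `n`. -/
def HasSpecialEmbedding (n m : ℕ) : ObjectProperty (ModuleCat.{u} R) := fun M =>
  ∃ (Y Q : ModuleCat.{u} R) (f : M →ₗ[R] Y) (q : Y →ₗ[R] Q), IsSES f q ∧ yLevel R n m Y ∧
    HasProjectiveDimensionLE Q n

theorem IsSES.hasProjectiveDimensionLE {A B C : ModuleCat.{u} R} {i : A →ₗ[R] B} {p : B →ₗ[R] C}
    (h : IsSES i p) (hA : HasProjectiveDimensionLE A n) (hC : HasProjectiveDimensionLE C n) :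
    HasProjectiveDimensionLE B n :=
  h.shortExact.hasProjectiveDimensionLT_X₂ (n + 1) hA hC

theorem hasProjectiveDimensionLE_of_projective {F : ModuleCat.{u} R}
    (hF : Module.Projective R F) : HasProjectiveDimensionLE F n :=
  have := projective_of_module hF
  hasProjectiveDimensionLT_of_ge F 1 (n + 1) (by omega)

variable [IsArtinianRing R] [HasFiniteInjectiveEmbeddings R]

/-- Since `I` is injective, this is the vanishing of `Ext²(Q, Y)`; it lets extensions of `C` by `Y`
be prolonged in the next lemma. -/
theorem ext_cokernel_eq_zero {Q Y I N : ModuleCat.{u} R} {f : Y →ₗ[R] I} {π : I →ₗ[R] N}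
    (hs : IsSES f π) (hI : finiteInjectives R I) (hQ : HasProjectiveDimensionLE Q n)
    (hY : yUnion R n Y) (e : Ext Q N 1) : e = 0 := by
  obtain ⟨x, rfl⟩ := Ext.covariant_sequence_exact₃ Q hs.shortExact e rfl
    (ext_eq_zero_of_yUnion hQ hY (by omega) _)
  rw [ext_eq_zero_of_finiteInjectives hI le_rfl x, Ext.zero_comp]

/-- A horseshoe lemma: the pushout extension `B` of `C` by `Y` prolongs to an extension `E` of `Y'`
by `Y`, because `Ext²(Q', Y) = 0`. The cokernel of `X → E` is an extension of `Q'` by `Q`. -/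
theorem hasSpecialEmbedding_of_star {a b : ℕ} {X : ModuleCat.{u} R}
    (h : star (HasSpecialEmbedding n a) (HasSpecialEmbedding n b) X) :
    HasSpecialEmbedding n (a + b) X := by
  obtain ⟨A, C, j, p, hs, ⟨Y, Q, f, q, hfq, hY, hQ⟩, ⟨Y', Q', f', q', hfq', hY', hQ'⟩⟩ := h
  obtain ⟨B, i, r, β, hB, hrβ, hβ, hk⟩ := exists_pushout hs f
  obtain ⟨t, htβ, hti⟩ := hk Q 0 q (by rw [hfq.comp_eq_zero, LinearMap.zero_comp])
  have hβt : IsSES β t := hs.cokernel_middle hB hfq hβ hrβ hti htβ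
  obtain ⟨I, ι, hI, hI', hι⟩ := HasFiniteInjectiveEmbeddings.exists_embedding Y
    (finite_of_yLevel Y hY)
  have hN := IsSES.of_injective hι
  obtain ⟨v, hv⟩ := hI'.exists_extend hB.inj ι
  -- The map `w : C → I / Y` classifies the extension `B`; its extension `w'` to `Y'` yields `E` by
  -- pullback.
  obtain ⟨w, hw⟩ := hB.exists_desc ((LinearMap.range ι).mkQ ∘ₗ v) (by
    rw [LinearMap.comp_assoc, hv, hN.comp_eq_zero])
  obtain ⟨w', hw'⟩ := hfq'.exists_extend_of_ext (D := ModuleCat.of R (I ⧸ LinearMap.range ι))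
    (ext_cokernel_eq_zero hN ⟨hI, hI'⟩ hQ' ⟨a, hY⟩) w
  obtain ⟨E, iE, pE, c, hE, hc, hpc, hkE⟩ := exists_pullback hN w'
  obtain ⟨h, hch, hph⟩ := hkE B v (f' ∘ₗ r) (by rw [← hw, ← hw', LinearMap.comp_assoc])
  have hhi : h ∘ₗ i = iE := by
    ext y
    have h₁ : pE (h (i y)) = f' (r (i y)) := congr($hph _)
    obtain ⟨z, hz⟩ := (hE.exact (h (i y) - iE y)).1 (by
      rw [map_sub, h₁, hB.apply_apply, map_zero, hE.apply_apply, sub_zero])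
    have h₂ : ∀ z, c (iE z) = ι z := fun z => congr($hc z)
    have h₃ : c (h (i y)) = ι y := by
      rw [show c (h (i y)) = v (i y) from congr($hch _)]
      exact congr($hv y)
    have h₄ : ι z = 0 := by rw [← h₂, hz, map_sub, h₃, h₂, sub_self]
    rw [(map_eq_zero_iff _ hι).1 h₄, map_zero] at hz
    exact (sub_eq_zero.1 hz.symm)
  have hhq : IsSES h (q' ∘ₗ pE) := hB.cokernel_middle' hE hfq' hhi hph
  obtain ⟨T, s, α, γ, hs', hT⟩ := hβt.exists_comp hhq
  exact ⟨E, T, h ∘ₗ β, s, hs', yLevel_add ⟨Y, Y', iE, pE, hE, hY, hY'⟩,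
    hT.hasProjectiveDimensionLE hQ hQ'⟩

/-- If `𝒴ₙ` is covariantly finite, then minimal left approximations are injective with cokernel of
projective dimension at most `n`. -/
theorem exists_special_minimalLeftApprox (h : CovariantlyFinite (yUnion R n))
    {M : ModuleCat.{u} R} (hM : Module.Finite R M) :
    ∃ (Y Q : ModuleCat.{u} R) (f : M →ₗ[R] Y) (q : Y →ₗ[R] Q),
      IsMinimalLeftApprox (yUnion R n) f ∧ IsSES f q ∧ HasProjectiveDimensionLE Q n := by
  obtain ⟨Y, f, hf⟩ := exists_minimalLeftApprox finite_of_yUnion closedUnderSummands_yUnion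
    (covariantlyFinite_iff.1 h M hM)
  obtain ⟨I, g, hI, hI', hg⟩ := HasFiniteInjectiveEmbeddings.exists_embedding M hM
  obtain ⟨k, hk⟩ := hf.approx.2 I g (yUnion_of_finiteInjectives ⟨hI, hI'⟩)
  have hinj : Function.Injective f := by
    rw [← hk] at hg
    exact Function.Injective.of_comp hg
  have hs := IsSES.of_injective hinj
  have hY := finite_of_yUnion Y hf.approx.1
  refine ⟨Y, ModuleCat.of R (Y ⧸ LinearMap.range f), f, _, hf, hs, ?_⟩
  refine hasProjectiveDimensionLE_of_ext (inferInstanceAs (Module.Finite R (Y ⧸ _)))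
    fun C hC => ?_
  rw [add_comm]
  exact ext_eq_zero_of_finite_of_cosyzygies le_rfl (fun X hX =>
    hf.ext_cokernel_eq_zero (fun _ => yUnion_of_star) hs
      (inferInstanceAs (Module.Finite R (Y ⧸ _))) ⟨1, yLevel_one_of_cosyzygies hX⟩) hC

/-- Pushing `0 → ker π → F → M → 0` out along a special embedding `ker π → Y` gives `E` as an
extension of `M` by `Y` and of `Q` by `F`. The latter bounds `pd E`; the former gives the lifting
property, as `Ext¹(D, Y) = 0` for `D` in `𝒫ₙ`. -/
theorem contravariantlyFinite_projDimLE (h : CovariantlyFinite (yUnion R n)) :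
    ContravariantlyFinite (projDimLE R n) := by
  intro M hM
  obtain ⟨F, π, hF, hF', hπ⟩ := exists_free_cover hM
  have hs := IsSES.of_surjective hπ
  obtain ⟨Y, Q, f, q, hf, hfq, hQ⟩ := exists_special_minimalLeftApprox h
    (M := ModuleCat.of R (LinearMap.ker π)) hs.finite_left
  obtain ⟨E, i, p, b, hE, hpb, hbi, hk⟩ := exists_pushout hs f
  obtain ⟨t, htb, hti⟩ := hk Q 0 q (by rw [hfq.comp_eq_zero, LinearMap.zero_comp])
  have hbt : IsSES b t := hs.cokernel_middle hE hfq hbi hpb hti htb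
  have := finite_of_yUnion Y hf.approx.1
  refine ⟨E, ModuleCat.ofHom p, ⟨hE.finite_middle,
    hbt.hasProjectiveDimensionLE (hasProjectiveDimensionLE_of_projective hF') hQ⟩,
    fun D g hD => ?_⟩
  obtain ⟨k, hk⟩ := hE.exists_lift_of_ext
    (ext_eq_zero_of_yUnion hD.2 hf.approx.1 le_rfl) g.hom
  exact ⟨ModuleCat.ofHom k, ModuleCat.hom_ext hk⟩

omit [IsArtinianRing R] [HasFiniteInjectiveEmbeddings R] in
theorem IsLeftApprox.pi_comp {P : ObjectProperty (ModuleCat.{u} R)} {N C : ModuleCat.{u} R}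
    {c : N →ₗ[R] C} (hc : IsLeftApprox P c) {k : ℕ} (hC : P (ModuleCat.of R (Fin k → C)))
    {M : ModuleCat.{u} R} {i : M →ₗ[R] (Fin k → N)} {p : (Fin k → N) →ₗ[R] M}
    (hip : p ∘ₗ i = LinearMap.id) :
    IsLeftApprox P (C := ModuleCat.of R (Fin k → C))
      (LinearMap.pi (fun j => c ∘ₗ LinearMap.proj j) ∘ₗ i) := by
  refine ⟨hC, fun D g hD => ?_⟩
  choose h hh using fun j => hc.2 D (g ∘ₗ p ∘ₗ LinearMap.single R (fun _ => N) j) hD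
  refine ⟨∑ j, h j ∘ₗ LinearMap.proj j, ?_⟩
  have key : (∑ j, h j ∘ₗ LinearMap.proj j) ∘ₗ LinearMap.pi (fun j => c ∘ₗ LinearMap.proj j) =
      g ∘ₗ p := by
    refine LinearMap.ext fun x => ?_
    have hx : ∀ j, h j (c (x j)) = g (p (Pi.single j (x j))) := fun j => congr($(hh j) (x j))
    simp only [LinearMap.comp_apply, LinearMap.sum_apply, LinearMap.proj_apply, LinearMap.pi_apply,
      hx]
    rw [← map_sum, ← map_sum, Finset.univ_sum_single]
  rw [← LinearMap.comp_assoc, key, LinearMap.comp_assoc, hip, LinearMap.comp_id]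

/-- The uniform bound originates here: `m` is the level of one approximation `C` of `R / J`. The
minimal approximation of a summand of `(R / J)ᵏ` has as target a summand of `Cᵏ`, which again has
level `m`. -/
theorem exists_hasSpecialEmbedding_of_jacobson (h : CovariantlyFinite (yUnion R n)) :
    ∃ m, ∀ M : ModuleCat.{u} R, Module.Finite R M →
      (∀ r ∈ Ring.jacobson R, ∀ x : M, r • x = 0) → HasSpecialEmbedding n m M := by
  obtain ⟨C, c, ⟨m, hC⟩, hc⟩ := covariantlyFinite_iff.1 h (ModuleCat.of R (R ⧸ Ring.jacobson R))
    (inferInstanceAs (Module.Finite R (R ⧸ Ring.jacobson R)))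
  refine ⟨m, fun M hM hJ => ?_⟩
  obtain ⟨k, i, p, hip⟩ := exists_summand_pi_quotient_jacobson hM hJ
  have hCk : yLevel R n m (ModuleCat.of R (Fin k → C)) :=
    have := (closedUnderSummands_yLevel (R := R) (n := n) m).isClosedUnderIsomorphisms
    prop_pi (yLevel R n m) (addClosure_of_prop (filtered_mono finite_of_cosyzygies
      (cosyzygies_of_subsingleton n) m.zero_le (filtered_zero_iff.2 inferInstance)))
      yLevel_prod (fun _ => C) fun _ => hC
  obtain ⟨Y, Q, f, q, hf, hfq, hQ⟩ := exists_special_minimalLeftApprox h hM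
  obtain ⟨s, t, hst, -⟩ := hf.exists_summand
    (IsLeftApprox.pi_comp (P := yUnion R n) ⟨⟨m, hC⟩, hc⟩ ⟨m, hCk⟩ hip)
  exact ⟨Y, Q, f, q, hfq, closedUnderSummands_yLevel m s t hst hCk, hQ⟩

theorem exists_hasSpecialEmbedding (h : CovariantlyFinite (yUnion R n)) :
    ∃ m, ∀ M : ModuleCat.{u} R, Module.Finite R M → HasSpecialEmbedding n m M := by
  obtain ⟨m, hm⟩ := exists_hasSpecialEmbedding_of_jacobson h
  obtain ⟨l, hl⟩ := IsSemiprimaryRing.isNilpotent (R := R)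
  have key : ∀ (k : ℕ) (M : ModuleCat.{u} R), Module.Finite R M →
      (Ring.jacobson R ^ k • ⊤ : Submodule R M) = ⊥ → HasSpecialEmbedding n (k * m) M := by
    intro k
    induction k with
    | zero =>
      intro M hM hJ
      rw [Submodule.pow_zero, Ideal.one_eq_top, Submodule.top_smul] at hJ
      have : Subsingleton M := (Submodule.subsingleton_iff R).1 (subsingleton_of_bot_eq_top hJ.symm)
      refine ⟨M, ModuleCat.of R PUnit, LinearMap.id, 0, IsSES.zero_right, ?_,
        hasProjectiveDimensionLE_of_projective inferInstance⟩
      exact addClosure_of_prop (filtered_mono finite_of_cosyzygies (cosyzygies_of_subsingleton n)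
        (Nat.zero_le _) (filtered_zero_iff.2 this))
    | succ k ih =>
      intro M hM hJ
      let N : Submodule R M := Ring.jacobson R • ⊤
      have hs := IsSES.subtype_mkQ N
      -- The submodule `J M` is killed by `J ^ k` and contributes `k * m`; the quotient `M / J M` is
      -- killed by `J` and contributes `m`.
      rw [Nat.succ_mul]
      refine hasSpecialEmbedding_of_star ⟨ModuleCat.of R N, ModuleCat.of R (M ⧸ N), _, _, hs,
        ih _ hs.finite_left ?_, hm _ hs.finite_right fun r hr x => ?_⟩
      · refine Submodule.map_injective_of_injective N.injective_subtype ?_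
        rw [Submodule.map_smul'', Submodule.map_bot, Submodule.map_top, Submodule.range_subtype,
          ← Submodule.mul_smul, ← Submodule.pow_succ, hJ]
      · obtain ⟨y, rfl⟩ := N.mkQ_surjective x
        rw [← map_smul, Submodule.mkQ_apply, Submodule.Quotient.mk_eq_zero]
        exact Submodule.smul_mem_smul hr trivial
  refine ⟨l * m, fun M hM => key l M hM ?_⟩
  rw [hl]
  exact Submodule.bot_smul _

theorem exists_yUnion_eq (h : CovariantlyFinite (yUnion R n)) :
    ∃ m, 0 < m ∧ yUnion R n = yLevel R n m := by
  obtain ⟨m, hm⟩ := exists_hasSpecialEmbedding h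
  -- The bound `m` may be zero; passing to `m + 1` only secures positivity.
  refine ⟨m + 1, m.succ_pos, ?_⟩
  ext X
  refine ⟨fun hX => yLevel_mono m.le_succ ?_, fun hX => ⟨_, hX⟩⟩
  obtain ⟨Y, Q, f, q, hfq, hY, hQ⟩ := hm X (finite_of_yUnion X hX)
  obtain ⟨k, hk⟩ := hfq.exists_extend_of_ext (ext_eq_zero_of_yUnion hQ hX le_rfl) LinearMap.id
  exact closedUnderSummands_yLevel m f k hk hY

end SpecialApproximations

end ModSubcat

theorem proposition2p13 (K : Type*) [Field K] (Λ : Type u) [Ring Λ] [Algebra K Λ]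
    [Module.Finite K Λ] (n : ℕ) :
    -- `Λᵐᵒᵖ`-modules are the right `Λ`-modules
    ((ModSubcat.yLevel Λᵐᵒᵖ n 1).IsClosedUnderExtensions →
      ∃ m : ℕ, 0 < m ∧ ModSubcat.yUnion Λᵐᵒᵖ n = ModSubcat.yLevel Λᵐᵒᵖ n m) ∧
    ((∃ m : ℕ, 0 < m ∧ ModSubcat.yUnion Λᵐᵒᵖ n = ModSubcat.yLevel Λᵐᵒᵖ n m) ↔
      ∃ m : ℕ, 0 < m ∧ (ModSubcat.yLevel Λᵐᵒᵖ n m).IsClosedUnderExtensions) ∧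
    ((∃ m : ℕ, 0 < m ∧ (ModSubcat.yLevel Λᵐᵒᵖ n m).IsClosedUnderExtensions) ↔
      ModSubcat.CovariantlyFinite (ModSubcat.yUnion Λᵐᵒᵖ n)) ∧
    (ModSubcat.CovariantlyFinite (ModSubcat.yUnion Λᵐᵒᵖ n) →
      ModSubcat.ContravariantlyFinite (ModSubcat.projDimLE Λᵐᵒᵖ n)) := by
  have hfin : Module.Finite K Λᵐᵒᵖ := Module.Finite.equiv (MulOpposite.opLinearEquiv K)
  have : IsArtinianRing Λᵐᵒᵖ := IsArtinianRing.of_finite K Λᵐᵒᵖ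
  have := ModSubcat.hasFiniteInjectiveEmbeddings_of_finite K Λᵐᵒᵖ
  refine ⟨fun h => ⟨1, one_pos, ModSubcat.yUnion_eq_of_isClosedUnderExtensions one_pos h⟩,
    ⟨?_, ?_⟩, ⟨?_, fun h => ?_⟩, ModSubcat.contravariantlyFinite_projDimLE⟩
  · rintro ⟨m, hm, h⟩
    exact ⟨m, hm, ModSubcat.isClosedUnderExtensions_of_yUnion_eq h⟩
  · rintro ⟨m, hm, h⟩
    exact ⟨m, hm, ModSubcat.yUnion_eq_of_isClosedUnderExtensions hm h⟩
  · rintro ⟨m, hm, h⟩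
    rw [ModSubcat.yUnion_eq_of_isClosedUnderExtensions hm h]
    exact ModSubcat.covariantlyFinite_yLevel n m
  · obtain ⟨m, hm, h⟩ := ModSubcat.exists_yUnion_eq h
    exact ⟨m, hm, ModSubcat.isClosedUnderExtensions_of_yUnion_eq h⟩
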